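/- **Conventions.** Let $p\le q$ be integers and $[p,q]=\{p,p+1,\dots,q\}$. A simplicial complex on $[p,q]$ is a family $\Sigma$ of subsets of $[p,q]$ containing $\emptyset$ and closed under taking subsets; $\dim F=|F|-1$, $\Sigma_i$ is the set of $i$-dimensional faces, $f_i(\Sigma)=|\Sigma_i|$, and $\dim\Sigma$ is the largest dimension of a face. $\Sigma$ is *shifted* if $F\setminus\{j\}\cup\{i\}\in\Sigma$ whenever $i<j$ are in $[p,q]$, $F\in\Sigma$, $i\notin F$, $j\in F$. $\tilde H_i(\cdot)$ is reduced simplicial homology over $\mathbb Z$ and $\tilde\beta_i$ its rank. A $d$-dimensional complex is *acyclic in positive codimension* (APC) if $\tilde\beta_i=0$ for all $i<d$. A *simplicial spanning tree* of a $d$-dimensional complex $\Sigma$ is a $d$-dimensional subcomplex $\Upsilon\subseteq\Sigma$ containing all faces of $\Sigma$ of dimension $<d$ such that $\tilde H_d(\Upsilon)=0$, $\tilde H_{d-1}(\Upsilon)$ is finite, and $f_d(\Upsilon)=f_d(\Sigma)-\tilde\beta_d(\Sigma)+\tilde\beta_{d-1}(\Sigma)$; let $\mathcal T(\Sigma)$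 be the set of these. Let $x_{i,j}$ ($i,j\in\mathbb Z$) be indeterminates over a field of characteristic $0$, and $X_{i,j}=x_{i,j}^2$. For a multiset of integers $S=\{i_1\le\dots\le i_m\}$ put $x_S=x_{1,i_1}x_{2,i_2}\cdots x_{m,i_m}$ and $X_S=x_S^2$. Let $\uparrow$ be the field automorphism, fixing the coefficients, of the rational function field with $\uparrow x_{i,j}=x_{i+1,j}$. For multisets $S,T$ of integers put $$z(S,T)=\frac{1}{\uparrow X_S}\sum_{j\in T}X_{S\cup j},$$ where $\cup$ is multiset union (multiplicities add). The finely weighted spanning tree enumerator of a $d$-dimensional complex is $$\hat\tau_d(\Sigma)=\sum_{\Upsilon\in\mathcal T(\Sigma)}|\tilde H_{d-1}(\Upsilon)|^2\prod_{F\in\Upsilon_d}X_F .$$ Let $\mathcal F$ be a finite family of finite sets of integers, all of the same size. A *critical pair* of $\mathcal F$ is a pair $(A,B)$ with $A=\{a_1<\dots<a_m\}\in\mathcal F$, $B\notin\mathcal F$, and $B=A\setminus\{a_i\}\cup\{a_i+1\}$ for some $i$ with $a_i+1\notin A$. Its *long signature* is $(S,T)$ with $S=\{a_1,\dots,a_{i-1}\}$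 and $T=\{j\in\mathbb Z: p'\le j\le a_i\}$, where $p'$ is the smallest integer occurring in a member of $\mathcal F$. Let $\overline{\mathrm{sig}}(\mathcal F)$ be the multiset of long signatures of the critical pairs of $\mathcal F$. **Theorem.** Let $d\ge 0$ and let $\Sigma$ be a $d$-dimensional APC shifted complex on $[p,q]$, with initial vertex $p$. Let $\Delta=\mathrm{del}_p\Sigma=\{F\setminus\{p\}:F\in\Sigma\}$ and $\Lambda=\mathrm{link}_p\Sigma=\{F: p\notin F,\ F\cup\{p\}\in\Sigma\}$, and write $\tilde F=F\cup\{p\}$, $\tilde S=S\cup\{p\}$, $\tilde T=T\cup\{p\}$. Then $$\hat\tau_d(\Sigma)=\Big(\prod_{F\in\Lambda_{d-1}}X_{\tilde F}\Big)\prod_{(S,T)\in\overline{\mathrm{sig}}(\Delta_d)}\frac{z(S,\tilde T)}{X_{1,p}} =\Big(\prod_{F\in\Lambda_{d-1}}X_{\tilde F}\Big)\prod_{(S,T)\in\overline{\mathrm{sig}}(\Delta_d)}\frac{\sum_{j\in\tilde T}X_{S\cup j}}{X_{\tilde S}} .$$ -/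

import Mathlib

noncomputable section

namespace ShiftedTrees

/-! ### Simplicial complexes, given as finite families of finite sets of integers -/

/-- `K` is a simplicial complex on the finite vertex set `V`: a family of subsets of `V` that
contains `∅` and is closed under passing to subsets. -/
structure IsComplexOn (V : Finset ℤ) (K : Finset (Finset ℤ)) : Prop where
  subset_vertices : ∀ F ∈ K, F ⊆ V
  empty_mem : ∅ ∈ K
  down_closed : ∀ F ∈ K, ∀ G ⊆ F, G ∈ K

/-- A complex on the vertex set `[p,q]` is shifted if replacing a vertex of a face by a smaller
vertex that is not in the face always gives a face. -/
def IsShifted (p q : ℤ) (K : Finset (Finset ℤ)) : Prop :=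
  ∀ i ∈ Finset.Icc p q, ∀ j ∈ Finset.Icc p q, i < j →
    ∀ F ∈ K, i ∉ F → j ∈ F → insert i (F.erase j) ∈ K

/-- The set `K_i` of `i`-dimensional faces, `dim F = |F| - 1`. -/
def facesOfDim (K : Finset (Finset ℤ)) (i : ℤ) : Finset (Finset ℤ) :=
  K.filter fun F => (F.card : ℤ) = i + 1

/-- The dimension of a complex, the maximum of the dimensions of its faces. -/
def dim (K : Finset (Finset ℤ)) : ℤ := (K.sup Finset.card : ℕ) - 1

/-- The `i`-skeleton `K_(i)`, all faces of dimension at most `i`. -/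
def skeleton (K : Finset (Finset ℤ)) (i : ℤ) : Finset (Finset ℤ) :=
  K.filter fun F => (F.card : ℤ) ≤ i + 1

/-- The deletion `del_p K = {F \ {p} : F ∈ K}`. -/
def del (p : ℤ) (K : Finset (Finset ℤ)) : Finset (Finset ℤ) :=
  K.image fun F => F.erase p

/-- The link `link_p K = {F : p ∉ F, F ∪ {p} ∈ K}`, each of whose members is `G \ {p}` for a
face `G = F ∪ {p}` of `K`. -/
def link (p : ℤ) (K : Finset (Finset ℤ)) : Finset (Finset ℤ) :=
  (K.image fun G => G.erase p).filter fun F => p ∉ F ∧ insert p F ∈ K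

/-! ### Reduced simplicial homology with integer coefficients -/

/-- The sign `ε(v,F) = (-1)^(j+1)` where `v` is the `j`-th smallest element of `F`. -/
def sign (v : ℤ) (F : Finset ℤ) : ℤ := (-1) ^ (F.filter fun u => u < v).card

/-- The simplicial boundary map `∂[F] = ∑_{j ∈ F} ε(j,F) [F \ j]`, on the free abelian group on
all finite sets of integers. In particular `∂[∅] = 0` and `∂[{v}] = [∅]`. -/
def boundary : (Finset ℤ →₀ ℤ) →ₗ[ℤ] (Finset ℤ →₀ ℤ) :=
  Finsupp.linearCombination ℤ fun F => ∑ j ∈ F, Finsupp.single (F.erase j) (sign j F)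

/-- The chain group `C_i(K)`, free on the `i`-dimensional faces of `K`. -/
def chains (K : Finset (Finset ℤ)) (i : ℤ) : Submodule ℤ (Finset ℤ →₀ ℤ) :=
  Finsupp.supported ℤ ℤ (facesOfDim K i : Set (Finset ℤ))

/-- The kernel of `∂ : C_i(K) → C_{i-1}(K)`. -/
def cycles (K : Finset (Finset ℤ)) (i : ℤ) : Submodule ℤ (Finset ℤ →₀ ℤ) :=
  chains K i ⊓ LinearMap.ker boundary

/-- The image of `∂ : C_{i+1}(K) → C_i(K)`. -/
def boundaries (K : Finset (Finset ℤ)) (i : ℤ) : Submodule ℤ (Finset ℤ →₀ ℤ) :=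
  (chains K (i + 1)).map boundary

/-- The reduced homology group `H̃_i(K; ℤ)`. -/
abbrev Homology (K : Finset (Finset ℤ)) (i : ℤ) : Type :=
  cycles K i ⧸ (boundaries K i).submoduleOf (cycles K i)

/-- The reduced Betti number, the rank of `H̃_i(K; ℤ)`. -/
def betti (K : Finset (Finset ℤ)) (i : ℤ) : ℕ := Module.finrank ℤ (Homology K i)

/-- `K` is acyclic in positive codimension: all reduced Betti numbers below the top dimension
vanish. -/
def IsAPC (K : Finset (Finset ℤ)) : Prop := ∀ i < dim K, betti K i = 0

/-! ### Simplicial spanning trees -/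

/-- `U` is a simplicial spanning tree of the `d`-dimensional complex `K` (on the vertex set `V`). -/
structure IsSpanningTree (V : Finset ℤ) (d : ℤ) (K U : Finset (Finset ℤ)) : Prop where
  isComplexOn : IsComplexOn V U
  dim_eq : dim U = d
  subset : U ⊆ K
  skeleton_eq : skeleton U (d - 1) = skeleton K (d - 1)
  acyclic : Subsingleton (Homology U d)
  finite : Finite (Homology U (d - 1))
  count : ((facesOfDim U d).card : ℤ) =
    (facesOfDim K d).card - betti K d + betti K (d - 1)

open Classical in
/-- The set of simplicial spanning trees of the `d`-dimensional complex `K`. -/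
def spanningTrees (V : Finset ℤ) (d : ℤ) (K : Finset (Finset ℤ)) :
    Finset (Finset (Finset ℤ)) :=
  K.powerset.filter fun U => IsSpanningTree V d K U

/-! ### The combinatorial fine weighting -/

variable (k : Type*) [Field k]

/-- The field of rational functions over `k` in indeterminates `x_{i,j}`, `i, j ∈ ℤ`. -/
abbrev RatFun : Type _ := FractionRing (MvPolynomial (ℤ × ℤ) k)

/-- The indeterminate `x_{i,j}`. -/
def xvar (i j : ℤ) : RatFun k := algebraMap _ _ (MvPolynomial.X (R := k) (i, j))

/-- `X_{i,j} = x_{i,j}²`. -/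
def Xvar (i j : ℤ) : RatFun k := xvar k i j ^ 2

/-- `x_S = x_{1,i₁} x_{2,i₂} ⋯ x_{m,iₘ}` for a multiset `S = {i₁ ≤ i₂ ≤ ⋯ ≤ iₘ}`. -/
def xmon (S : Multiset ℤ) : RatFun k :=
  ((S.sort (· ≤ ·)).mapIdx fun n v => xvar k (n + 1) v).prod

/-- `X_S = x_S²`. -/
def Xmon (S : Multiset ℤ) : RatFun k := xmon k S ^ 2

/-- The raising operator `↑`, the field automorphism over `k` with `x_{i,j} ↦ x_{i+1,j}`. -/
def raising : RatFun k ≃+* RatFun k :=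
  IsFractionRing.ringEquivOfRingEquiv
    (MvPolynomial.renameEquiv k ((Equiv.addRight (1 : ℤ)).prodCongr (Equiv.refl ℤ))).toRingEquiv

/-- The `z`-polynomial `z(S,T) = (1 / ↑X_S) ∑_{j ∈ T} X_{S ∪ j}`, with multiset union. -/
def zpoly (S T : Multiset ℤ) : RatFun k :=
  1 / raising k (Xmon k S) * (T.map fun j => Xmon k (j ::ₘ S)).sum

/-- The finely weighted spanning tree enumerator
`τ̂_d(K) = ∑_U |H̃_{d-1}(U; ℤ)|² X_U`, `X_U = ∏_{F ∈ U_d} X_F`, the sum being over all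
simplicial spanning trees `U` of the `d`-dimensional complex `K`. -/
def tauHat (V : Finset ℤ) (d : ℤ) (K : Finset (Finset ℤ)) : RatFun k :=
  ∑ U ∈ spanningTrees V d K,
    (Nat.card (Homology U (d - 1)) : RatFun k) ^ 2 * ∏ F ∈ facesOfDim U d, Xmon k F.val

/-! ### Critical pairs and long signatures -/

/-- `B` covers `A` in the componentwise order: `B` arises from `A = {a₁ < ⋯ < aₘ}` by replacing
one element `aᵢ` by `aᵢ + 1 ∉ A`. -/
def Covers (A B : Finset ℤ) : Prop :=
  ∃ a ∈ A, a + 1 ∉ A ∧ B = insert (a + 1) (A.erase a)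

/-- The set of critical pairs of a family; see `mem_criticalPairs`. -/
def criticalPairs (𝓕 : Finset (Finset ℤ)) : Finset (Finset ℤ × Finset ℤ) :=
  𝓕.biUnion fun A =>
    (A.filter fun a => a + 1 ∉ A ∧ insert (a + 1) (A.erase a) ∉ 𝓕).image
      fun a => (A, insert (a + 1) (A.erase a))

theorem mem_criticalPairs (𝓕 : Finset (Finset ℤ)) (A B : Finset ℤ) :
    (A, B) ∈ criticalPairs 𝓕 ↔ A ∈ 𝓕 ∧ B ∉ 𝓕 ∧ Covers A B := by
  simp only [criticalPairs, Covers, Finset.mem_biUnion, Finset.mem_image, Finset.mem_filter,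
    Prod.mk.injEq]
  constructor
  · rintro ⟨A', hA', a, ⟨ha, ha1, hB⟩, rfl, rfl⟩
    exact ⟨hA', hB, a, ha, ha1, rfl⟩
  · rintro ⟨hA, hB, a, ha, ha1, rfl⟩
    exact ⟨A, hA, a, ⟨ha, ha1, hB⟩, rfl, rfl⟩

/-- The smallest integer occurring in a member of the family. -/
def initialVertex (𝓕 : Finset (Finset ℤ)) : ℤ := sInf {v : ℤ | ∃ F ∈ 𝓕, v ∈ F}

/-- For a critical pair `(A,B)`, the element `aᵢ` of `A` that is replaced by `aᵢ + 1` in `B`,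
that is, the unique element of `A \ B`. -/
def movedVertex (A B : Finset ℤ) : ℤ := sSup ((A \ B : Finset ℤ) : Set ℤ)

theorem movedVertex_eq (A : Finset ℤ) (a : ℤ) (ha : a ∈ A) :
    movedVertex A (insert (a + 1) (A.erase a)) = a := by
  have h : A \ insert (a + 1) (A.erase a) = {a} := by
    ext x
    simp only [Finset.mem_sdiff, Finset.mem_insert, Finset.mem_erase, Finset.mem_singleton]
    constructor
    · rintro ⟨h1, h2⟩
      by_contra h3
      exact h2 (Or.inr ⟨h3, h1⟩)
    · rintro rfl
      exact ⟨ha, by simp⟩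
  rw [movedVertex, h]
  simp

/-- The long signature `(S,T)` of a critical pair `(A,B)`: with `aᵢ` the moved vertex,
`S = {a₁, …, aᵢ₋₁}` and `T = {j : p ≤ j ≤ aᵢ}`. -/
def longSignature (p : ℤ) (P : Finset ℤ × Finset ℤ) : Finset ℤ × Finset ℤ :=
  (P.1.filter fun a => a < movedVertex P.1 P.2, Finset.Icc p (movedVertex P.1 P.2))

/-- The multiset of long signatures of the critical pairs of a family, with `p` the smallest
integer occurring in the family. -/
def longSignatures (𝓕 : Finset (Finset ℤ)) : Multiset (Finset ℤ × Finset ℤ) :=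
  (criticalPairs 𝓕).val.map (longSignature (initialVertex 𝓕))

end ShiftedTrees

end

/-! Write `𝓕` for the `d`-faces, `Λ` for the `(d-1)`-faces of the link of `p`, and `Δ` for the
`d`-faces avoiding `p`. The proof turns the tree sum into a determinant and then diagonalizes a
weighted Laplacian of `Δ` by induction on the vertex set.

Shiftedness and vanishing of the rational homology in degree `d-1` force the cone from `p` over
every `(d-1)`-face avoiding `p` to be a face (`insert_mem_of_betti_eq_zero`). Hence a `(d-1)`-cycle
is freely determined by its coefficients on `Λ`, and for a subcomplex `U` with the full
`(d-1)`-skeleton, homology in degree `d-1` is the cokernel of the boundary matrix with rows `Λ` and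
columns the `d`-faces of `U`. Spanning trees are therefore the nonsingular maximal sets of columns,
the squared determinant is the squared order of the homology, and Cauchy–Binet gives
`tauHat_eq_det`.

In that determinant the columns of cones `G ∪ p` form an identity block. Extracting their weights
leaves `det (1 + A A') = det (1 + A' A)`, with `A` the incidence matrix of `Λ` and `Δ` and `A'` its
weighted transpose. The matrix `A' A` is the Laplacian of `Δ` with entries scaled by `c = 1 /
X_{1,p}` (`det_reduced_laplacian`).

The spectrum comes from `charpoly_laplacian`: the nonzero eigenvalues are `c * z(S,T)` over the long
signatures. Splitting a shifted family at its initial vertex puts its Laplacian in the form `[a + E,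
a A; A', A' A]`, where `a = c W_{1,p}`, `E` is the Laplacian of the link for raised weights, and `E
A = 0` because `∂² = 0`. The spectrum is then that of the link and of the deletion, both translated
by `a`, up to copies of `a` and `0`. Critical pairs obey the same recursion (`criticalProd_eq`),
since adjoining `p` to `T` adds exactly `a` to the eigenvalue. For `Δ` with `c = 1 / X_{1,p}` the
translation is by `1`, which absorbs the `1` in `det (1 + A' A)` and produces the set `T ∪ p` of the
formula. -/

noncomputable section

namespace ShiftedTrees

open Matrix Polynomial

/-! ### Cauchy–Binet and the characteristic polynomial of a block matrix -/

section MatrixLemmas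

variable {m n : Type*} [Fintype m] [Fintype n] [DecidableEq m] [DecidableEq n]

/-- The Cauchy–Binet formula. -/
theorem det_mul_eq_sum_powersetCard {R : Type*} [CommRing R] (A : Matrix m n R)
    (B : Matrix n m R) :
    (A * B).det = ∑ s ∈ (Finset.univ : Finset n).powersetCard (Fintype.card m),
      ((B.submatrix (Subtype.val : s → n) id) * (A.submatrix id (Subtype.val : s → n))).det := by
  have h1 : det (1 + (X : R[X]) • (A * B).map C) = det (1 + (X : R[X]) • (B * A).map C) := by
    rw [Matrix.map_mul, Matrix.map_mul, ← Matrix.smul_mul, det_one_add_mul_comm,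
      Matrix.mul_smul]
  -- In top degree the only minor of `A * B` is its determinant, while `B * A` contributes all its
  -- principal minors of that size.
  have h2 := congrArg (fun f => f.coeff (Fintype.card m)) h1
  simp only [coeff_det_one_add_X_smul_eq_sum_minors] at h2
  rw [← Finset.card_univ, Finset.powersetCard_self, Finset.sum_singleton] at h2
  rw [← Finset.card_univ]
  have h3 := det_submatrix_equiv_self (Equiv.subtypeUnivEquiv (p := fun x => x ∈ Finset.univ)
    (fun x : m => Finset.mem_univ x)) (A * B)
  rw [← h3]
  exact h2

theorem det_mul_submatrix_of_equiv {R : Type*} [CommRing R] {s : Type*} [Fintype s]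
    [DecidableEq s] (e : s ≃ m) (A : Matrix m s R) (B : Matrix s m R) :
    (B * A).det = (A.submatrix id e.symm).det * (B.submatrix e.symm id).det := by
  rw [mul_comm, ← det_mul]
  rw [← Matrix.det_submatrix_equiv_self e.symm (B * A)]
  rfl

variable {K : Type*} [Field K]

/-- Substitution `X ↦ X - a` is a ring homomorphism, so it passes through the determinant; this
expresses a spectrum translated by `a`. -/
theorem charmatrix_det_comp (M : Matrix m m K) (a : K) :
    (scalar m (X - C a : K[X]) - M.map C).det = M.charpoly.comp (X - C a) := by
  rw [charpoly, charmatrix, ← coe_compRingHom_apply, RingHom.map_det]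
  congr 1
  ext i j
  by_cases h : i = j <;> simp [h]

/-- The characteristic polynomial of the block matrix `[a + E, a A; A', A' A]` when `E A = 0` and
`A' E = 0`. -/
theorem charpoly_fromBlocks_of_mul_eq_zero (A : Matrix m n K) (A' : Matrix n m K)
    (E : Matrix m m K) (a : K) (h₁ : E * A = 0) :
    (fromBlocks (scalar m a + E) (a • A) A' (A' * A)).charpoly *
        (X - C a) ^ Fintype.card m =
      X ^ Fintype.card n * (A * A').charpoly.comp (X - C a) * E.charpoly.comp (X - C a) := by
  set M := fromBlocks (scalar m a + E) (a • A) A' (A' * A)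
  set b : K[X] := X - C a
  have hE : E.map C * A.map C = (0 : Matrix m n K[X]) := by
    rw [← Matrix.map_mul, h₁]; simp
  have hM : charmatrix M = fromBlocks (scalar m b - E.map C) (-(C a • A.map C))
      (-(A'.map C)) (scalar n X - A'.map C * A.map C) := by
    ext i j
    rcases i with i | i <;> rcases j with j | j
    · by_cases h : i = j <;> simp [M, b, charmatrix, h, sub_sub]
    · simp [M, charmatrix]
    · simp [M, charmatrix]
    · by_cases h : i = j <;> simp [M, charmatrix, h, Matrix.mul_apply]
  -- The right factor is chosen to clear the lower left block: `-A' (X - A A') + (X - A' A) A' = 0`.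
  have key : charmatrix M * fromBlocks (scalar m X - A.map C * A'.map C) 0 (A'.map C) 1 =
      fromBlocks ((X : K[X]) • (scalar m b - E.map C - A.map C * A'.map C)) (-(C a • A.map C)) 0
        (scalar n X - A'.map C * A.map C) := by
    rw [hM, fromBlocks_multiply]
    congr 1
    · have : E.map C * (A.map C * A'.map C) = (0 : Matrix m m K[X]) := by
        rw [← Matrix.mul_assoc, hE, Matrix.zero_mul]
      rw [Matrix.sub_mul, Matrix.mul_sub, Matrix.mul_sub, this]
      simp only [scalar_apply, ← smul_eq_diagonal_mul, ← smul_eq_mul_diagonal, b]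
      refine Matrix.ext fun i j => ?_
      by_cases h : i = j <;> simp [h, Matrix.diagonal] <;> ring
    · simp
    · simp only [scalar_apply, Matrix.sub_mul, Matrix.mul_sub, ← smul_eq_diagonal_mul,
        Matrix.neg_mul, ← smul_eq_mul_diagonal, Matrix.mul_assoc, smul_neg]
      abel
    · simp
  -- Since `E A = 0`, the cross term vanishes and `E` and `A A'` contribute independent factors to
  -- the determinant.
  have key2 : (scalar m b - E.map C) * (scalar m b - A.map C * A'.map C) =
      b • (scalar m b - E.map C - A.map C * A'.map C) := by
    have : E.map C * (A.map C * A'.map C) = (0 : Matrix m m K[X]) := by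
      rw [← Matrix.mul_assoc, hE, Matrix.zero_mul]
    rw [Matrix.sub_mul, Matrix.mul_sub, Matrix.mul_sub, this]
    simp only [scalar_apply, ← smul_eq_diagonal_mul, ← smul_eq_mul_diagonal]
    refine Matrix.ext fun i j => ?_
    by_cases h : i = j <;> simp [h, Matrix.diagonal] <;> ring
  have d1 := congrArg det key
  have d2 := congrArg det key2
  rw [det_mul, det_fromBlocks_zero₁₂, det_one, mul_one, det_fromBlocks_zero₂₁, det_smul] at d1
  rw [det_mul, det_smul] at d2
  have e1 : (scalar m X - A.map C * A'.map C : Matrix m m K[X]).det = (A * A').charpoly := by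
    rw [charpoly, charmatrix, ← Matrix.map_mul]; rfl
  have e2 : (scalar n X - A'.map C * A.map C : Matrix n n K[X]).det = (A' * A).charpoly := by
    rw [charpoly, charmatrix, ← Matrix.map_mul]; rfl
  rw [← Matrix.map_mul, charmatrix_det_comp, charmatrix_det_comp] at d2
  rw [e1, e2] at d1
  have d3 := charpoly_mul_comm' A A'
  refine mul_right_cancel₀ (charpoly_monic (A * A')).ne_zero ?_
  change M.charmatrix.det * b ^ _ * _ = _
  rw [← Matrix.map_mul] at d1
  calc M.charmatrix.det * b ^ Fintype.card m * (A * A').charpoly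
      = (M.charmatrix.det * (A * A').charpoly) * b ^ Fintype.card m := by ring
    _ = (X ^ Fintype.card m * (A' * A).charpoly) * (b ^ Fintype.card m *
          (scalar m b - E.map C - (A * A').map C).det) := by rw [d1]; ring
    _ = _ := by rw [← d2, ← d3]; ring

theorem det_one_add_eq_charpoly (M : Matrix m m K) :
    (1 + M).det = (-1) ^ Fintype.card m * M.charpoly.eval (-1) := by
  rw [eval_charpoly, ← det_neg]
  congr 1
  ext i j
  by_cases h : i = j <;> simp [h, add_comm]

end MatrixLemmas

/-- The cokernel of a nonsingular integer matrix has order `|det|`. -/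
theorem natCard_quotient_range {m : Type*} [Fintype m] [DecidableEq m] (M : Matrix m m ℤ)
    (h : M.det ≠ 0) :
    Nat.card ((m → ℤ) ⧸ LinearMap.range M.mulVecLin) = M.det.natAbs := by
  have hinj : Function.Injective M.mulVecLin := Matrix.mulVec_injective_of_det_ne_zero h
  rw [← Submodule.natAbs_det_equiv _ (LinearEquiv.ofInjective _ hinj)]
  rw [← LinearMap.det_toLin']
  rfl

/-! ### Incidence numbers -/

/-- The incidence number of `G` in `F`, the coefficient of `[G]` in `∂[F]`. -/
def incidence (G F : Finset ℤ) : ℤ := boundary (Finsupp.single F 1) G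

theorem boundary_single (F : Finset ℤ) :
    boundary (Finsupp.single F 1) = ∑ j ∈ F, Finsupp.single (F.erase j) (sign j F) := by
  simp [boundary, Finsupp.linearCombination_single]

theorem incidence_eq_sum (G F : Finset ℤ) :
    incidence G F = ∑ j ∈ F, if F.erase j = G then sign j F else 0 := by
  rw [incidence, boundary_single, Finsupp.finsetSum_apply]
  exact Finset.sum_congr rfl fun j _ => by rw [Finsupp.single_apply]

theorem incidence_eq_zero {G F : Finset ℤ} (h : ∀ j ∈ F, F.erase j ≠ G) :
    incidence G F = 0 := by
  rw [incidence_eq_sum]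
  exact Finset.sum_eq_zero fun j hj => if_neg (h j hj)

theorem exists_erase_of_incidence_ne_zero {G F : Finset ℤ} (h : incidence G F ≠ 0) :
    ∃ j ∈ F, F.erase j = G := by
  by_contra! h'
  exact h (incidence_eq_zero h')

theorem boundary_apply_eq_sum {s : Finset (Finset ℤ)} {c : Finset ℤ →₀ ℤ} (hc : c.support ⊆ s)
    (G : Finset ℤ) : boundary c G = ∑ F ∈ s, c F * incidence G F := by
  have h : c = ∑ F ∈ s, c F • Finsupp.single F (1 : ℤ) := by
    conv_lhs => rw [← Finsupp.sum_single c, Finsupp.sum_of_support_subset c hc _ (by simp)]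
    simp
  conv_lhs => rw [h, map_sum, Finsupp.finsetSum_apply]
  exact Finset.sum_congr rfl fun F _ => by rw [map_smul]; rfl

/-- Removing the smaller vertex lowers the position of `j` by one, while removing the larger leaves
the position of `i` unchanged. -/
theorem sign_erase_mul_sign {F : Finset ℤ} {i j : ℤ} (hi : i ∈ F) (hij : i < j) :
    sign j F * sign i (F.erase j) = -(sign i F * sign j (F.erase i)) := by
  have h1 : (F.erase j).filter (fun u => u < i) = F.filter (fun u => u < i) := by
    ext u; simp only [Finset.mem_filter, Finset.mem_erase]
    constructor
    · rintro ⟨⟨_, h⟩, h'⟩; exact ⟨h, h'⟩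
    · rintro ⟨h, h'⟩; exact ⟨⟨by omega, h⟩, h'⟩
  have h2 : (F.erase i).filter (fun u => u < j) = (F.filter (fun u => u < j)).erase i := by
    rw [Finset.filter_erase]
  have h3 : i ∈ F.filter (fun u => u < j) := by simp [hi, hij]
  have h4 := Finset.card_erase_add_one h3
  simp only [sign, h1, h2, ← h4]
  ring

theorem boundary_boundary_single (F : Finset ℤ) :
    boundary (boundary (Finsupp.single F 1)) = 0 := by
  have h : boundary (boundary (Finsupp.single F 1)) = ∑ j ∈ F, ∑ i ∈ F,
      if i = j then 0 else
        Finsupp.single ((F.erase j).erase i) (sign j F * sign i (F.erase j)) := by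
    rw [boundary_single, map_sum]
    refine Finset.sum_congr rfl fun j hj => ?_
    rw [← mul_one (sign j F), ← smul_eq_mul, ← Finsupp.smul_single, map_smul, boundary_single,
      Finset.smul_sum, ← Finset.sum_erase_add F _ hj]
    rw [if_pos rfl, add_zero]
    refine Finset.sum_congr rfl fun i hi => ?_
    rw [if_neg (Finset.ne_of_mem_erase hi), Finsupp.smul_single]
    simp
  -- Exchanging the two removed vertices reverses every sign, so the double boundary is its own
  -- negative; over `ℤ` it must vanish.
  have h2 : boundary (boundary (Finsupp.single F 1)) =
      -boundary (boundary (Finsupp.single F 1)) := by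
    conv_lhs => rw [h, Finset.sum_comm]
    rw [h, ← Finset.sum_neg_distrib]
    refine Finset.sum_congr rfl fun i hi => ?_
    rw [← Finset.sum_neg_distrib]
    refine Finset.sum_congr rfl fun j hj => ?_
    rcases lt_trichotomy i j with hij | rfl | hij
    · rw [if_neg hij.ne, if_neg hij.ne', sign_erase_mul_sign hi hij, Finset.erase_right_comm,
        Finsupp.single_neg]
    · simp
    · rw [if_neg hij.ne, if_neg hij.ne', sign_erase_mul_sign hj hij, Finset.erase_right_comm,
        Finsupp.single_neg, neg_neg]
  ext G
  have := DFunLike.congr_fun h2 G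
  rw [Finsupp.neg_apply] at this
  rw [Finsupp.zero_apply]
  omega

theorem boundary_boundary (c : Finset ℤ →₀ ℤ) : boundary (boundary c) = 0 := by
  have : boundary ∘ₗ boundary = 0 := by
    ext F : 2
    simpa using boundary_boundary_single F
  exact LinearMap.congr_fun this c

/-- This is `∂² = 0` read off in coefficients. Any `s` containing the facets of `F` suffices, so the
link can serve as `s`. -/
theorem sum_incidence_mul_incidence {s : Finset (Finset ℤ)} {F : Finset ℤ}
    (hs : ∀ j ∈ F, F.erase j ∈ s) (H : Finset ℤ) :
    ∑ G ∈ s, incidence H G * incidence G F = 0 := by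
  have h1 : (boundary (Finsupp.single F 1)).support ⊆ s := by
    intro G hG
    rw [Finsupp.mem_support_iff] at hG
    obtain ⟨j, hj, rfl⟩ := exists_erase_of_incidence_ne_zero hG
    exact hs j hj
  have h2 := boundary_apply_eq_sum h1 H
  rw [boundary_boundary] at h2
  rw [Finsupp.zero_apply] at h2
  rw [h2]
  exact Finset.sum_congr rfl fun G _ => mul_comm _ _

theorem sign_insert_of_lt {p j : ℤ} {G : Finset ℤ} (hp : p ∉ G) (h : p < j) :
    sign j (insert p G) = -sign j G := by
  rw [sign, Finset.filter_insert, if_pos h, Finset.card_insert_of_notMem (by simp [hp]), sign]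
  ring

theorem sign_insert_self {p : ℤ} {G : Finset ℤ} (h : ∀ j ∈ G, p < j) :
    sign p (insert p G) = 1 := by
  have : (insert p G).filter (fun u => u < p) = ∅ := by
    ext u; simp only [Finset.mem_filter, Finset.mem_insert, Finset.notMem_empty, iff_false]
    rintro ⟨rfl | h1, h2⟩
    · omega
    · have := h u h1; omega
  rw [sign, this]; simp

/-! ### Incidence numbers of cones from a vertex below all others -/

section Cone

variable {p : ℤ} {G : Finset ℤ}

theorem notMem_of_forall_lt (h : ∀ j ∈ G, p < j) : p ∉ G := fun hp => lt_irrefl p (h p hp)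

theorem incidence_insert_insert {H : Finset ℤ} (hG : ∀ j ∈ G, p < j) (hH : p ∉ H) :
    incidence (insert p H) (insert p G) = -incidence H G := by
  have hp := notMem_of_forall_lt hG
  rw [incidence_eq_sum, incidence_eq_sum, Finset.sum_insert hp, ← Finset.sum_neg_distrib,
    Finset.erase_insert hp, if_neg, zero_add]
  · refine Finset.sum_congr rfl fun j hj => ?_
    have hpj : p ≠ j := fun h => hp (h ▸ hj)
    rw [Finset.erase_insert_of_ne hpj, sign_insert_of_lt hp (hG j hj)]
    by_cases h : G.erase j = H
    · rw [if_pos h, if_pos (by rw [h])]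
    · rw [if_neg h, if_neg, neg_zero]
      intro h'
      apply h
      have := congrArg (fun s => s.erase p) h'
      simpa [Finset.erase_insert, hH, hp] using this
  · intro h
    exact hp (h ▸ Finset.mem_insert_self p H)

theorem incidence_insert_right {H : Finset ℤ} (hG : ∀ j ∈ G, p < j) (hH : p ∉ H) :
    incidence H (insert p G) = if H = G then 1 else 0 := by
  have hp := notMem_of_forall_lt hG
  rw [incidence_eq_sum, Finset.sum_insert hp, Finset.erase_insert hp, sign_insert_self hG,
    Finset.sum_eq_zero, add_zero]
  · simp only [eq_comm]
  · intro j hj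
    have hpj : p ≠ j := fun h => hp (h ▸ hj)
    rw [if_neg]
    rintro rfl
    exact hH (by simp [hpj])

theorem incidence_insert_left {F H : Finset ℤ} (hF : p ∉ F) :
    incidence (insert p H) F = 0 := by
  refine incidence_eq_zero fun j _ h => hF ?_
  exact Finset.mem_of_mem_erase (h ▸ Finset.mem_insert_self p H)

end Cone

/-! ### Weights depending on vertex and position -/

section Weights

variable {R : Type*}

/-- The weight `W 1 i₁ * W 2 i₂ * ⋯ * W m iₘ` of a multiset `{i₁ ≤ i₂ ≤ ⋯ ≤ iₘ}`. -/
def weight [CommMonoid R] (W : ℤ → ℤ → R) (S : Multiset ℤ) : R :=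
  ((S.sort (· ≤ ·)).mapIdx fun n v => W (n + 1) v).prod

/-- The weights raised by one position. -/
def raise (W : ℤ → ℤ → R) : ℤ → ℤ → R := fun i j => W (i + 1) j

/-- A least element takes position 1 and pushes all others up by one, which is where the raised
weights come from. Ties are harmless, so repeated elements are allowed. -/
theorem weight_cons [CommMonoid R] (W : ℤ → ℤ → R) {a : ℤ} {S : Multiset ℤ}
    (h : ∀ b ∈ S, a ≤ b) : weight W (a ::ₘ S) = W 1 a * weight (raise W) S := by
  rw [weight, weight, Multiset.sort_cons (r := (· ≤ ·)) _ _ h, List.mapIdx_cons, List.prod_cons]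
  simp [raise]

theorem weight_insert [CommMonoid R] (W : ℤ → ℤ → R) {p : ℤ} {G : Finset ℤ}
    (h : ∀ j ∈ G, p < j) :
    weight W (insert p G).val = W 1 p * weight (raise W) G.val := by
  rw [Finset.insert_val_of_notMem (notMem_of_forall_lt h)]
  exact weight_cons W fun b hb => (h b hb).le

theorem weight_ne_zero [Field R] {W : ℤ → ℤ → R} (hW : ∀ i j, W i j ≠ 0) (S : Multiset ℤ) :
    weight W S ≠ 0 := by
  rw [weight]
  refine List.prod_ne_zero ?_
  intro h
  rw [List.mem_mapIdx] at h
  obtain ⟨i, hi, h⟩ := h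
  exact hW _ _ h

theorem map_weight {R' F : Type*} [CommMonoid R] [CommMonoid R'] [FunLike F R R']
    [MonoidHomClass F R R'] (f : F) (W : ℤ → ℤ → R) (S : Multiset ℤ) :
    f (weight W S) = weight (fun i j => f (W i j)) S := by
  rw [weight, weight, map_list_prod, List.mapIdx_eq_zipIdx_map, List.mapIdx_eq_zipIdx_map,
    List.map_map]
  rfl

end Weights

/-! ### Shifted families -/

theorem IsShifted.filter_notMem {p q : ℤ} {𝓕 : Finset (Finset ℤ)} (h : IsShifted p q 𝓕) :
    IsShifted (p + 1) q (𝓕.filter (p ∉ ·)) := by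
  intro i hi j hj hij F hF hiF hjF
  rw [Finset.mem_Icc] at hi hj
  rw [Finset.mem_filter] at hF ⊢
  refine ⟨h i (by simp; omega) j (by simp; omega) hij F hF.1 hiF hjF, ?_⟩
  simp only [Finset.mem_insert, Finset.mem_erase, not_or, not_and]
  exact ⟨by omega, fun _ => hF.2⟩

theorem mem_link {p : ℤ} {𝓕 : Finset (Finset ℤ)} {G : Finset ℤ} :
    G ∈ link p 𝓕 ↔ p ∉ G ∧ insert p G ∈ 𝓕 := by
  rw [link, Finset.mem_filter, and_iff_right_iff_imp]
  rintro ⟨h1, h2⟩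
  exact Finset.mem_image.2 ⟨_, h2, Finset.erase_insert h1⟩

theorem IsShifted.shifted_link {p q : ℤ} {𝓕 : Finset (Finset ℤ)} (h : IsShifted p q 𝓕) :
    IsShifted (p + 1) q (link p 𝓕) := by
  intro i hi j hj hij F hF hiF hjF
  rw [Finset.mem_Icc] at hi hj
  rw [mem_link] at hF ⊢
  have hp : p ∉ insert i (F.erase j) := by
    simp only [Finset.mem_insert, Finset.mem_erase, not_or, not_and]
    exact ⟨by omega, fun _ => hF.1⟩
  refine ⟨hp, ?_⟩
  have := h i (by simp; omega) j (by simp; omega) hij _ hF.2 (by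
    simp only [Finset.mem_insert, not_or]; exact ⟨by omega, hiF⟩) (by simp [hjF])
  rwa [Finset.erase_insert_of_ne (by omega), Finset.insert_comm] at this

theorem subset_Icc_succ {p q : ℤ} {F : Finset ℤ} (h : F ⊆ Finset.Icc p q) (hp : p ∉ F) :
    F ⊆ Finset.Icc (p + 1) q := by
  intro j hj
  have h1 := Finset.mem_Icc.1 (h hj)
  have h2 : j ≠ p := fun h => hp (h ▸ hj)
  rw [Finset.mem_Icc]; omega

theorem forall_lt_of_subset_Icc_succ {p q : ℤ} {F : Finset ℤ}
    (h : F ⊆ Finset.Icc (p + 1) q) : ∀ j ∈ F, p < j := by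
  intro j hj
  have h1 := Finset.mem_Icc.1 (h hj)
  omega

/-- A family of sets on the vertex set `[p,q]`, closed under replacing vertices by smaller ones. -/
structure IsShiftedFamily (p q : ℤ) (𝓕 : Finset (Finset ℤ)) : Prop where
  subset_Icc : ∀ F ∈ 𝓕, F ⊆ Finset.Icc p q
  isShifted : IsShifted p q 𝓕

namespace IsShiftedFamily

variable {p q : ℤ} {𝓕 : Finset (Finset ℤ)}

theorem filter_notMem (h : IsShiftedFamily p q 𝓕) :
    IsShiftedFamily (p + 1) q (𝓕.filter (p ∉ ·)) where
  subset_Icc F hF := by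
    rw [Finset.mem_filter] at hF
    exact subset_Icc_succ (h.subset_Icc F hF.1) hF.2
  isShifted := h.isShifted.filter_notMem

theorem link_family (h : IsShiftedFamily p q 𝓕) : IsShiftedFamily (p + 1) q (link p 𝓕) where
  subset_Icc F hF := by
    rw [mem_link] at hF
    exact subset_Icc_succ ((Finset.subset_insert _ _).trans (h.subset_Icc _ hF.2)) hF.1
  isShifted := h.isShifted.shifted_link

/-- The shadow of the deletion of the initial vertex is contained in the link. -/
theorem erase_mem_link (h : IsShiftedFamily p q 𝓕) {F : Finset ℤ} (hF : F ∈ 𝓕) (hp : p ∉ F)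
    {j : ℤ} (hj : j ∈ F) : F.erase j ∈ link p 𝓕 := by
  have h1 := Finset.mem_Icc.1 (h.subset_Icc F hF hj)
  have h2 : j ≠ p := fun h => hp (h ▸ hj)
  rw [mem_link]
  exact ⟨fun h => hp (Finset.mem_of_mem_erase h), h.isShifted p (by simp; omega) j
    (by simp; omega) (by omega) F hF hp hj⟩

end IsShiftedFamily

/-! ### Splitting a family at a vertex -/

/-- A family is the disjoint union of the cone over its link at `p` and its members
avoiding `p`. -/
def linkSumEquiv (p : ℤ) (𝓕 : Finset (Finset ℤ)) :
    link p 𝓕 ⊕ 𝓕.filter (p ∉ ·) ≃ 𝓕 :=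
  Equiv.ofBijective
    (Sum.elim (fun G => ⟨insert p G.1, (mem_link.1 G.2).2⟩)
      (fun F => ⟨F.1, (Finset.mem_filter.1 F.2).1⟩)) <| by
    constructor
    · rintro (⟨G, hG⟩ | ⟨F, hF⟩) (⟨G', hG'⟩ | ⟨F', hF'⟩) h
      · have h1 : insert p G = insert p G' := congrArg Subtype.val h
        have h2 := congrArg (fun s => s.erase p) h1
        simp only [Finset.erase_insert (mem_link.1 hG).1,
          Finset.erase_insert (mem_link.1 hG').1] at h2
        subst h2; rfl
      · have h1 : insert p G = F' := congrArg Subtype.val h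
        exact absurd (h1 ▸ Finset.mem_insert_self p G) (Finset.mem_filter.1 hF').2
      · have h1 : F = insert p G' := congrArg Subtype.val h
        exact absurd (h1 ▸ Finset.mem_insert_self p G') (Finset.mem_filter.1 hF).2
      · have h1 : F = F' := congrArg Subtype.val h
        subst h1; rfl
    · rintro ⟨F, hF⟩
      by_cases hp : p ∈ F
      · refine ⟨Sum.inl ⟨F.erase p, mem_link.2 ⟨by simp, by rwa [Finset.insert_erase hp]⟩⟩, ?_⟩
        simp [Finset.insert_erase hp]
      · exact ⟨Sum.inr ⟨F, Finset.mem_filter.2 ⟨hF, hp⟩⟩, rfl⟩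

@[simp]
theorem coe_linkSumEquiv_inl (p : ℤ) (𝓕 : Finset (Finset ℤ)) (G : link p 𝓕) :
    (linkSumEquiv p 𝓕 (Sum.inl G) : Finset ℤ) = insert p G.1 := rfl

@[simp]
theorem coe_linkSumEquiv_inr (p : ℤ) (𝓕 : Finset (Finset ℤ)) (F : 𝓕.filter (p ∉ ·)) :
    (linkSumEquiv p 𝓕 (Sum.inr F) : Finset ℤ) = F.1 := rfl

theorem prod_eq_prod_link_mul_prod_filter {M : Type*} [CommMonoid M] (p : ℤ)
    (𝓕 : Finset (Finset ℤ)) (g : Finset ℤ → M) :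
    ∏ F ∈ 𝓕, g F = (∏ G ∈ link p 𝓕, g (insert p G)) * ∏ F ∈ 𝓕.filter (p ∉ ·), g F := by
  rw [← Finset.prod_coe_sort 𝓕, ← Finset.prod_coe_sort (link p 𝓕),
    ← Finset.prod_coe_sort (𝓕.filter _), ← (linkSumEquiv p 𝓕).prod_comp, Fintype.prod_sum_type]
  simp

theorem card_eq_card_link_add_card_filter (p : ℤ) (𝓕 : Finset (Finset ℤ)) :
    𝓕.card = (link p 𝓕).card + (𝓕.filter (p ∉ ·)).card := by
  have := Fintype.card_congr (linkSumEquiv p 𝓕)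
  simpa only [Fintype.card_sum, Fintype.card_coe] using this.symm

/-! ### Products over critical pairs -/

/-- The elements of `A` whose increment gives a critical pair of `𝓕`. -/
def criticalVertices (𝓕 : Finset (Finset ℤ)) (A : Finset ℤ) : Finset ℤ :=
  A.filter fun a => a + 1 ∉ A ∧ insert (a + 1) (A.erase a) ∉ 𝓕

/-- The product of a function of the long signatures of the critical pairs of a family. -/
def criticalProd {M : Type*} [CommMonoid M] (p : ℤ) (𝓕 : Finset (Finset ℤ))
    (f : Finset ℤ → Finset ℤ → M) : M :=
  ∏ A ∈ 𝓕, ∏ a ∈ criticalVertices 𝓕 A, f (A.filter (· < a)) (Finset.Icc p a)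

/-- A critical pair records `A` and determines the moved vertex, so nothing is lost in passing to a
double product over `A` and its critical vertices. -/
theorem prod_criticalPairs {M : Type*} [CommMonoid M] (p : ℤ) (𝓕 : Finset (Finset ℤ))
    (f : Finset ℤ × Finset ℤ → M) :
    (((criticalPairs 𝓕).val.map (longSignature p)).map f).prod =
      criticalProd p 𝓕 fun S T => f (S, T) := by
  rw [Multiset.map_map]
  change ∏ P ∈ criticalPairs 𝓕, f (longSignature p P) = _
  rw [criticalPairs, Finset.prod_biUnion]
  · refine Finset.prod_congr rfl fun A _ => ?_
    rw [Finset.prod_image]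
    · refine Finset.prod_congr rfl fun a ha => ?_
      rw [longSignature, movedVertex_eq A a (Finset.mem_filter.1 ha).1]
    · intro a ha b hb h
      have h2 := congrArg (fun P : Finset ℤ × Finset ℤ => movedVertex P.1 P.2) h
      simpa only [movedVertex_eq A a (Finset.mem_filter.1 ha).1,
        movedVertex_eq A b (Finset.mem_filter.1 hb).1] using h2
  · intro A _ B _ hAB
    rw [Function.onFun, Finset.disjoint_left]
    rintro P hP hP'
    rw [Finset.mem_image] at hP hP'
    obtain ⟨a, _, rfl⟩ := hP
    obtain ⟨b, _, h⟩ := hP'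
    exact hAB (congrArg Prod.fst h).symm

/-- The members of the link whose cone has its apex as a critical vertex. -/
def apexCritical (p : ℤ) (𝓕 : Finset (Finset ℤ)) : Finset (Finset ℤ) :=
  (link p 𝓕).filter fun G => p + 1 ∉ G ∧ insert (p + 1) G ∉ 𝓕.filter (p ∉ ·)

theorem Icc_eq_insert {p a : ℤ} (h : p ≤ a) :
    Finset.Icc p a = insert p (Finset.Icc (p + 1) a) := by
  ext x; simp only [Finset.mem_Icc, Finset.mem_insert]; omega

/-- A critical pair moves `p` itself, giving `(∅, {p})`; or moves another vertex of a cone, giving a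
critical pair of the link with `p` adjoined to `S` and `T`; or starts from a member avoiding `p`,
giving one of the deletion with `p` adjoined to `T` only. -/
theorem IsShiftedFamily.criticalProd_eq {p q : ℤ} {𝓕 : Finset (Finset ℤ)}
    (h : IsShiftedFamily p q 𝓕) {M : Type*} [CommMonoid M] (f : Finset ℤ → Finset ℤ → M) :
    criticalProd p 𝓕 f =
      f ∅ {p} ^ (apexCritical p 𝓕).card *
        criticalProd (p + 1) (link p 𝓕) (fun S T => f (insert p S) (insert p T)) *
        criticalProd (p + 1) (𝓕.filter (p ∉ ·)) (fun S T => f S (insert p T)) := by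
  rw [criticalProd, prod_eq_prod_link_mul_prod_filter p]
  congr 1
  · have key : ∀ G ∈ link p 𝓕,
        ∏ a ∈ criticalVertices 𝓕 (insert p G), f ((insert p G).filter (· < a)) (Finset.Icc p a) =
        (if p + 1 ∉ G ∧ insert (p + 1) G ∉ 𝓕.filter (p ∉ ·) then f ∅ {p} else 1) *
        ∏ a ∈ criticalVertices (link p 𝓕) G,
          f (insert p (G.filter (· < a))) (insert p (Finset.Icc (p + 1) a)) := by
      intro G hG
      have hlt := forall_lt_of_subset_Icc_succ (h.link_family.subset_Icc G hG)
      have hp := notMem_of_forall_lt hlt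
      have e1 : (p + 1 ∉ insert p G ∧ insert (p + 1) ((insert p G).erase p) ∉ 𝓕) ↔
          (p + 1 ∉ G ∧ insert (p + 1) G ∉ 𝓕.filter (p ∉ ·)) := by
        rw [Finset.erase_insert hp]
        simp [hp]
      have e2 : G.filter (fun a => a + 1 ∉ insert p G ∧
          insert (a + 1) ((insert p G).erase a) ∉ 𝓕) = criticalVertices (link p 𝓕) G := by
        refine Finset.filter_congr fun a ha => ?_
        have hpa := hlt a ha
        rw [Finset.erase_insert_of_ne (by omega), Finset.insert_comm, mem_link]
        have : p ∉ insert (a + 1) (G.erase a) := by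
          simp only [Finset.mem_insert, Finset.mem_erase, not_or, not_and]
          exact ⟨by omega, fun _ => hp⟩
        simp only [Finset.mem_insert, this, not_false_eq_true, true_and, not_or]
        constructor
        · rintro ⟨⟨_, h1⟩, h2⟩; exact ⟨h1, h2⟩
        · rintro ⟨h1, h2⟩; exact ⟨⟨by omega, h1⟩, h2⟩
      have e3 : ∏ a ∈ criticalVertices (link p 𝓕) G,
            f ((insert p G).filter (· < a)) (Finset.Icc p a) =
          ∏ a ∈ criticalVertices (link p 𝓕) G,
            f (insert p (G.filter (· < a))) (insert p (Finset.Icc (p + 1) a)) := by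
        refine Finset.prod_congr rfl fun a ha => ?_
        have hpa := hlt a (Finset.mem_filter.1 ha).1
        rw [Finset.filter_insert, if_pos hpa, Icc_eq_insert hpa.le]
      have e4 : (insert p G).filter (· < p) = ∅ := by
        refine Finset.filter_false_of_mem fun a ha => ?_
        rcases Finset.mem_insert.1 ha with rfl | ha
        · omega
        · have := hlt a ha; omega
      rw [criticalVertices, Finset.filter_insert, e2, ← e3]
      by_cases h' : p + 1 ∉ G ∧ insert (p + 1) G ∉ 𝓕.filter (p ∉ ·)
      · rw [if_pos (e1.2 h'), if_pos h', Finset.prod_insert, e4, Finset.Icc_self]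
        exact fun h'' => hp (Finset.mem_filter.1 h'').1
      · rw [if_neg (fun h'' => h' (e1.1 h'')), if_neg h', one_mul]
    rw [Finset.prod_congr rfl key, Finset.prod_mul_distrib]
    congr 1
    rw [← Finset.prod_filter, Finset.prod_const]
    rfl
  · refine Finset.prod_congr rfl fun A hA => ?_
    have hlt := forall_lt_of_subset_Icc_succ (h.filter_notMem.subset_Icc A hA)
    have hp := notMem_of_forall_lt hlt
    have e : criticalVertices 𝓕 A = criticalVertices (𝓕.filter (p ∉ ·)) A := by
      refine Finset.filter_congr fun a ha => ?_
      have hpa := hlt a ha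
      have : p ∉ insert (a + 1) (A.erase a) := by
        simp only [Finset.mem_insert, Finset.mem_erase, not_or, not_and]
        exact ⟨by omega, fun _ => hp⟩
      rw [Finset.mem_filter, and_iff_left this]
    rw [e]
    refine Finset.prod_congr rfl fun a ha => ?_
    rw [Icc_eq_insert (hlt a (Finset.mem_filter.1 ha).1).le]

/-- A member `G` of the link contains `p + 1`, or avoids it with `G ∪ {p + 1}` in the deletion, or
is apex-critical. This count balances the multiplicities in the spectral recursion. -/
theorem IsShiftedFamily.card_link {p q : ℤ} {𝓕 : Finset (Finset ℤ)}
    (h : IsShiftedFamily p q 𝓕) :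
    (link p 𝓕).card = (apexCritical p 𝓕).card + (link (p + 1) (link p 𝓕)).card +
      (link (p + 1) (𝓕.filter (p ∉ ·))).card := by
  rw [card_eq_card_link_add_card_filter (p + 1) (link p 𝓕)]
  have h1 := Finset.card_filter_add_card_filter_not
    (s := (link p 𝓕).filter (p + 1 ∉ ·)) (fun G => insert (p + 1) G ∈ 𝓕.filter (p ∉ ·))
  have h2 : ((link p 𝓕).filter (p + 1 ∉ ·)).filter
      (fun G => insert (p + 1) G ∈ 𝓕.filter (p ∉ ·)) = link (p + 1) (𝓕.filter (p ∉ ·)) := by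
    ext G
    rw [Finset.mem_filter, Finset.mem_filter, mem_link (p := p + 1)]
    constructor
    · rintro ⟨⟨_, h1⟩, h2⟩; exact ⟨h1, h2⟩
    · rintro ⟨h1, h2⟩
      -- Membership of `G` in the link of `p` holds because the link contains the shadow of the
      -- deletion.
      refine ⟨⟨?_, h1⟩, h2⟩
      rw [Finset.mem_filter] at h2
      have := h.erase_mem_link h2.1 h2.2 (Finset.mem_insert_self (p + 1) G)
      rwa [Finset.erase_insert h1] at this
  have h3 : ((link p 𝓕).filter (p + 1 ∉ ·)).filter
      (fun G => ¬ insert (p + 1) G ∈ 𝓕.filter (p ∉ ·)) = apexCritical p 𝓕 := by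
    rw [Finset.filter_filter]; rfl
  rw [h2, h3] at h1
  omega

theorem IsShiftedFamily.eq_empty_of_mem {p q : ℤ} {𝓕 : Finset (Finset ℤ)}
    (h : IsShiftedFamily p q 𝓕) (hpq : q < p) {F : Finset ℤ} (hF : F ∈ 𝓕) : F = ∅ := by
  have := h.subset_Icc F hF
  rwa [Finset.Icc_eq_empty (by omega), Finset.subset_empty] at this

theorem IsShiftedFamily.criticalProd_of_lt {p q : ℤ} {𝓕 : Finset (Finset ℤ)}
    (h : IsShiftedFamily p q 𝓕) (hpq : q < p) {M : Type*} [CommMonoid M]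
    (f : Finset ℤ → Finset ℤ → M) : criticalProd p 𝓕 f = 1 := by
  refine Finset.prod_eq_one fun A hA => ?_
  rw [h.eq_empty_of_mem hpq hA]
  rfl

theorem IsShiftedFamily.link_of_lt {p q : ℤ} {𝓕 : Finset (Finset ℤ)}
    (h : IsShiftedFamily p q 𝓕) (hpq : q < p) : link p 𝓕 = ∅ := by
  refine Finset.eq_empty_of_forall_notMem fun G hG => ?_
  exact (Finset.insert_ne_empty p G) (h.eq_empty_of_mem hpq (mem_link.1 hG).2)

/-- A shifted family has as many critical pairs as members containing the initial vertex. -/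
theorem IsShiftedFamily.criticalProd_const {p q : ℤ} {𝓕 : Finset (Finset ℤ)}
    (h : IsShiftedFamily p q 𝓕) {M : Type*} [CommMonoid M] (y : M) :
    criticalProd p 𝓕 (fun _ _ => y) = y ^ (link p 𝓕).card := by
  obtain ⟨n, hn⟩ : ∃ n : ℕ, n = (q + 1 - p).toNat := ⟨_, rfl⟩
  induction n generalizing p 𝓕 with
  | zero => rw [h.criticalProd_of_lt (by omega), h.link_of_lt (by omega)]; simp
  | succ n ih =>
    rw [h.criticalProd_eq, ih h.link_family (by omega), ih h.filter_notMem (by omega), h.card_link,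
      pow_add, pow_add]

theorem charpoly_submatrix_equiv {R m n : Type*} [CommRing R] [Fintype m] [Fintype n]
    [DecidableEq m] [DecidableEq n] (e : n ≃ m) (M : Matrix m m R) :
    (M.submatrix e e).charpoly = M.charpoly := by
  simpa [reindex_apply] using charpoly_reindex e.symm M

/-! ### The weighted up-down Laplacian of a shifted family -/

section Spectrum

variable {K : Type*} [Field K]

/-- The scaled weighted Laplacian of a family `𝓕`, with
`(F, F')`-entry `c * ∑ G, (W_F / ↑W_G) [G : F] [G : F']`. -/
def laplacian (V : Finset ℤ) (c : K) (W : ℤ → ℤ → K) (𝓕 : Finset (Finset ℤ)) :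
    Matrix 𝓕 𝓕 K :=
  of fun F F' => ∑ G ∈ V.powerset,
    c * (weight W F.1.val / weight (raise W) G.val) * incidence G F * incidence G F'

/-- The eigenvalue `c * z(S,T)` of the scaled weighted Laplacian. -/
def eigenvalue (c : K) (W : ℤ → ℤ → K) (S T : Finset ℤ) : K :=
  c * ((∑ j ∈ T, weight W (j ::ₘ S.val)) / weight (raise W) S.val)

theorem eigenvalue_empty_singleton (c : K) (W : ℤ → ℤ → K) (p : ℤ) :
    eigenvalue c W ∅ {p} = c * W 1 p := by
  simp [eigenvalue, weight]

/-- The new summand has weight `W 1 p` times the denominator, so it adds a constant independent of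
`S` and `T`. -/
theorem eigenvalue_insert_right {c : K} {W : ℤ → ℤ → K} (hW : ∀ i j, W i j ≠ 0) {p : ℤ}
    {S T : Finset ℤ} (hS : ∀ j ∈ S, p < j) (hT : p ∉ T) :
    eigenvalue c W S (insert p T) = eigenvalue c W S T + c * W 1 p := by
  have h0 : weight (raise W) S.val ≠ 0 := weight_ne_zero (fun i j => hW _ _) _
  have h1 : weight W (p ::ₘ S.val) = W 1 p * weight (raise W) S.val :=
    weight_cons W fun b hb => (hS b hb).le
  rw [eigenvalue, eigenvalue, Finset.sum_insert hT, h1]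
  field_simp
  ring

/-- The least vertex `p` factors out of every numerator at position 1 and out of the denominator at
position 2. The set `T` may itself contain `p`. -/
theorem eigenvalue_insert_left {c : K} {W : ℤ → ℤ → K} (hW : ∀ i j, W i j ≠ 0) {p : ℤ}
    {S T : Finset ℤ} (hS : ∀ j ∈ S, p < j) (hT : ∀ j ∈ T, p ≤ j) :
    eigenvalue c W (insert p S) T = eigenvalue (c * W 1 p / W 2 p) (raise W) S T := by
  have h1 : weight (raise W) (insert p S).val = W 2 p * weight (raise (raise W)) S.val :=
    weight_insert (raise W) hS
  have h2 : ∀ j ∈ T, weight W (j ::ₘ (insert p S).val) =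
      W 1 p * weight (raise W) (j ::ₘ S.val) := by
    intro j hj
    rw [Finset.insert_val_of_notMem (notMem_of_forall_lt hS), Multiset.cons_swap]
    refine weight_cons W fun b hb => ?_
    rcases Multiset.mem_cons.1 hb with rfl | hb
    · exact hT b hj
    · exact (hS b hb).le
  rw [eigenvalue, eigenvalue, h1, Finset.sum_congr rfl h2, ← Finset.mul_sum]
  have := hW 2 p
  have h0 : weight (raise (raise W)) S.val ≠ 0 := weight_ne_zero (fun i j => hW _ _) _
  field_simp

variable {p q : ℤ} {𝓕 : Finset (Finset ℤ)}

/-- The incidence matrix between the link and the deletion of a vertex. -/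
def linkIncidence (K : Type*) [Field K] (p : ℤ) (𝓕 : Finset (Finset ℤ)) :
    Matrix (link p 𝓕) (𝓕.filter (p ∉ ·)) K :=
  of fun G F => (incidence G F : K)

/-- The weighted coincidence matrix between the deletion and the link of a vertex. -/
def linkCoincidence (p : ℤ) (c : K) (W : ℤ → ℤ → K) (𝓕 : Finset (Finset ℤ)) :
    Matrix (𝓕.filter (p ∉ ·)) (link p 𝓕) K :=
  of fun F G => c * (weight W F.1.val / weight (raise W) G.1.val) * incidence G.1 F.1

namespace IsShiftedFamily

/-- Sums of incidence numbers over all faces reduce to sums over the link. -/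
theorem sum_powerset_eq_sum_link (h : IsShiftedFamily p q 𝓕) {F : Finset ℤ} (hF : F ∈ 𝓕)
    (hp : p ∉ F) (f : Finset ℤ → K) :
    ∑ G ∈ (Finset.Icc (p + 1) q).powerset, f G * incidence G F =
      ∑ G ∈ link p 𝓕, f G * incidence G F := by
  refine (Finset.sum_subset ?_ ?_).symm
  · intro G hG
    exact Finset.mem_powerset.2 (h.link_family.subset_Icc G hG)
  · intro G _ hG
    rw [incidence_eq_zero, Int.cast_zero, mul_zero]
    rintro j hj rfl
    exact hG (h.erase_mem_link hF hp hj)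

theorem linkCoincidence_mul_linkIncidence (h : IsShiftedFamily p q 𝓕) (c : K) (W : ℤ → ℤ → K) :
    linkCoincidence p c W 𝓕 * linkIncidence K p 𝓕 =
      laplacian (Finset.Icc (p + 1) q) c W (𝓕.filter (p ∉ ·)) := by
  ext F F'
  obtain ⟨h1, h2⟩ := Finset.mem_filter.1 F'.2
  rw [laplacian, of_apply, h.sum_powerset_eq_sum_link h1 h2, ← Finset.sum_coe_sort]
  rfl

/-- The inner sum is a coefficient of `∂²`, because the facets of a member of the deletion all lie
in the link. -/
theorem laplacian_link_mul_linkIncidence (h : IsShiftedFamily p q 𝓕) (V : Finset ℤ) (c : K)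
    (W : ℤ → ℤ → K) : laplacian V c W (link p 𝓕) * linkIncidence K p 𝓕 = 0 := by
  ext G F
  obtain ⟨h1, h2⟩ := Finset.mem_filter.1 F.2
  rw [Matrix.mul_apply, Matrix.zero_apply]
  simp only [laplacian, linkIncidence, of_apply, Finset.sum_mul]
  rw [Finset.sum_comm]
  refine Finset.sum_eq_zero fun H _ => ?_
  have key : (∑ G' ∈ link p 𝓕, (incidence H G' : K) * incidence G' F.1) = 0 := by
    exact_mod_cast congrArg (Int.cast : ℤ → K)
      (sum_incidence_mul_incidence (fun j hj => h.erase_mem_link h1 h2 hj) H)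
  simp only [mul_assoc]
  rw [← Finset.mul_sum, ← Finset.mul_sum, ← Finset.mul_sum,
    Finset.sum_coe_sort (link p 𝓕) (fun G' => (incidence H G' : K) * incidence G' F.1), key]
  simp

/-- The sum over faces splits into `H` and `H ∪ p` with `H` avoiding `p`. On two cones, the first
part gives the scalar `c * W 1 p` and the second the Laplacian of the link, its signs cancelling in
pairs. A mixed entry keeps one term, and on the deletion every `H ∪ p` contributes zero. -/
theorem laplacian_submatrix (h : IsShiftedFamily p q 𝓕) (hpq : p ≤ q) (c : K)
    {W : ℤ → ℤ → K} (hW : ∀ i j, W i j ≠ 0) :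
    (laplacian (Finset.Icc p q) c W 𝓕).submatrix (linkSumEquiv p 𝓕) (linkSumEquiv p 𝓕) =
      fromBlocks
        (scalar _ (c * W 1 p) +
          laplacian (Finset.Icc (p + 1) q) (c * W 1 p / W 2 p) (raise W) (link p 𝓕))
        ((c * W 1 p) • linkIncidence K p 𝓕) (linkCoincidence p c W 𝓕)
        (linkCoincidence p c W 𝓕 * linkIncidence K p 𝓕) := by
  rw [h.linkCoincidence_mul_linkIncidence]
  have hp : p ∉ Finset.Icc (p + 1) q := by simp
  have hsub : ∀ H ∈ (Finset.Icc (p + 1) q).powerset, ∀ j ∈ H, p < j := fun H hH =>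
    forall_lt_of_subset_Icc_succ (Finset.mem_powerset.1 hH)
  have hlt : ∀ G : link p 𝓕, ∀ j ∈ G.1, p < j := fun G =>
    forall_lt_of_subset_Icc_succ (h.link_family.subset_Icc _ G.2)
  have hF : ∀ F : 𝓕.filter (p ∉ ·), p ∉ F.1 := fun F => (Finset.mem_filter.1 F.2).2
  have hG0 : ∀ G : link p 𝓕, weight (raise W) G.1.val ≠ 0 := fun G =>
    weight_ne_zero (fun i j => hW _ _) _
  have hmem : ∀ G : link p 𝓕, G.1 ∈ (Finset.Icc (p + 1) q).powerset := fun G =>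
    Finset.mem_powerset.2 (h.link_family.subset_Icc _ G.2)
  ext i j
  rw [submatrix_apply, laplacian, of_apply, Icc_eq_insert hpq, Finset.sum_powerset_insert hp]
  rcases i with G | F <;> rcases j with G' | F' <;>
    simp only [coe_linkSumEquiv_inl, coe_linkSumEquiv_inr, fromBlocks_apply₁₁,
      fromBlocks_apply₁₂, fromBlocks_apply₂₁, fromBlocks_apply₂₂]
  · rw [Matrix.add_apply]
    congr 1
    · rw [Finset.sum_eq_single_of_mem G.1 (hmem G)]
      · rw [incidence_insert_right (hlt G) (notMem_of_forall_lt (hlt G)),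
          incidence_insert_right (hlt G') (notMem_of_forall_lt (hlt G)), weight_insert W (hlt G)]
        have := hG0 G
        by_cases hGG : G = G'
        · subst hGG
          simp only [if_true, scalar_apply, diagonal_apply_eq, Int.cast_one, mul_one]
          field_simp
        · have : (G : Finset ℤ) ≠ G' := fun h' => hGG (Subtype.ext h')
          simp [hGG, this]
      · intro H hH hne
        rw [incidence_insert_right (hlt G) (notMem_of_forall_lt (hsub H hH)), if_neg hne]
        simp
    · rw [laplacian, of_apply]
      refine Finset.sum_congr rfl fun H hH => ?_
      have hpH := notMem_of_forall_lt (hsub H hH)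
      rw [incidence_insert_insert (hlt G) hpH, incidence_insert_insert (hlt G') hpH,
        weight_insert W (hlt G), weight_insert (raise W) (hsub H hH)]
      have e1 : raise W 1 p = W 2 p := rfl
      have e2 := hW 2 p
      have e3 : weight (raise (raise W)) H.val ≠ 0 := weight_ne_zero (fun i j => hW _ _) _
      rw [e1]
      push_cast
      field_simp
  · rw [Finset.sum_eq_single_of_mem G.1 (hmem G), Finset.sum_eq_zero, add_zero]
    · rw [incidence_insert_right (hlt G) (notMem_of_forall_lt (hlt G)), weight_insert W (hlt G)]
      have := hG0 G
      simp only [if_true, Int.cast_one, Matrix.smul_apply, linkIncidence, of_apply, smul_eq_mul]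
      field_simp
    · intro H _
      rw [incidence_insert_left (hF F')]; simp
    · intro H hH hne
      rw [incidence_insert_right (hlt G) (notMem_of_forall_lt (hsub H hH)), if_neg hne]
      simp
  · rw [Finset.sum_eq_single_of_mem G'.1 (hmem G'), Finset.sum_eq_zero, add_zero]
    · rw [incidence_insert_right (hlt G') (notMem_of_forall_lt (hlt G'))]
      simp [linkCoincidence]
    · intro H _
      rw [incidence_insert_left (hF F)]; simp
    · intro H hH hne
      rw [incidence_insert_right (hlt G') (notMem_of_forall_lt (hsub H hH)), if_neg hne]
      simp
  · refine add_eq_left.2 ?_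
    refine Finset.sum_eq_zero fun H _ => ?_
    rw [incidence_insert_left (hF F)]; simp

/-- The characteristic polynomial of the weighted Laplacian of a shifted family. -/
theorem charpoly_laplacian (h : IsShiftedFamily p q 𝓕) (c : K) {W : ℤ → ℤ → K}
    (hW : ∀ i j, W i j ≠ 0) :
    (laplacian (Finset.Icc p q) c W 𝓕).charpoly = X ^ (𝓕.filter (p ∉ ·)).card *
      criticalProd p 𝓕 fun S T => X - C (eigenvalue c W S T) := by
  -- Induction on the number of vertices, with `c` and `W` varying, since the link brings in a
  -- rescaled constant and raised weights.
  obtain ⟨n, hn⟩ : ∃ n : ℕ, n = (q + 1 - p).toNat := ⟨_, rfl⟩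
  induction n generalizing p 𝓕 c W with
  | zero =>
    have hpq : q < p := by omega
    have h0 : laplacian (Finset.Icc p q) c W 𝓕 = 0 := by
      ext F F'
      rw [laplacian, of_apply]
      refine Finset.sum_eq_zero fun G _ => ?_
      rw [incidence_eq_zero (F := F.1) (by simp [h.eq_empty_of_mem hpq F.2])]
      simp
    have h1 := card_eq_card_link_add_card_filter p 𝓕
    rw [h.link_of_lt hpq, Finset.card_empty, zero_add] at h1
    rw [h.criticalProd_of_lt hpq, h0, mul_one, charpoly_zero, Fintype.card_coe, h1]
  | succ n ih =>
    have hpq : p ≤ q := by omega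
    set a := c * W 1 p with ha
    have hΔ := ih h.filter_notMem c hW (by omega)
    have hΛ := ih h.link_family (a / W 2 p) (W := raise W) (fun i j => hW _ _) (by omega)
    set n' := (𝓕.filter (p ∉ ·)).card with hn'
    set m' := (link p 𝓕).card with hm'
    set e := (apexCritical p 𝓕).card with he
    have hm := h.card_link
    have hm1 := card_eq_card_link_add_card_filter (p + 1) (link p 𝓕)
    have hn1 := card_eq_card_link_add_card_filter (p + 1) (𝓕.filter (p ∉ ·))
    set m0 := ((link p 𝓕).filter (p + 1 ∉ ·)).card
    set n0 := ((𝓕.filter (p ∉ ·)).filter (p + 1 ∉ ·)).card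
    set r1 := (link (p + 1) (𝓕.filter (p ∉ ·))).card
    set r2 := (link (p + 1) (link p 𝓕)).card
    set P₁ := criticalProd (p + 1) (𝓕.filter (p ∉ ·)) fun S T => X - C (eigenvalue c W S T)
      with hP₁
    set P₂ := criticalProd (p + 1) (link p 𝓕) fun S T =>
      X - C (eigenvalue (a / W 2 p) (raise W) S T) with hP₂
    have key := charpoly_fromBlocks_of_mul_eq_zero (linkIncidence K p 𝓕)
      (linkCoincidence p c W 𝓕) _ a
      (h.laplacian_link_mul_linkIncidence (Finset.Icc (p + 1) q) (a / W 2 p) (raise W))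
    rw [← h.laplacian_submatrix hpq c hW, hΛ] at key
    have hre : ((laplacian (Finset.Icc p q) c W 𝓕).submatrix (linkSumEquiv p 𝓕)
        (linkSumEquiv p 𝓕)).charpoly = (laplacian (Finset.Icc p q) c W 𝓕).charpoly :=
      charpoly_submatrix_equiv _ _
    have hAA := charpoly_mul_comm' (linkIncidence K p 𝓕) (linkCoincidence p c W 𝓕)
    rw [h.linkCoincidence_mul_linkIncidence, hΔ] at hAA
    simp only [Fintype.card_coe, ← hn', ← hm'] at hAA key
    -- `A A'` and `A' A` differ only in the multiplicity of zero; `card_link` makes the exponent of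
    -- `X` equal to `e + r2`.
    have hAA2 : (linkIncidence K p 𝓕 * linkCoincidence p c W 𝓕).charpoly =
        X ^ (e + r2) * P₁ := by
      refine mul_left_cancel₀ (pow_ne_zero n' (X_ne_zero (R := K))) ?_
      rw [hAA, ← mul_assoc, ← mul_assoc, ← pow_add, ← pow_add]
      congr 2
      omega
    rw [hre, hAA2] at key
    have hc1 : P₁.comp (X - C a) = criticalProd (p + 1) (𝓕.filter (p ∉ ·))
        fun S T => X - C (eigenvalue c W S (insert p T)) := by
      rw [hP₁, ← coe_compRingHom_apply, criticalProd, map_prod]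
      refine Finset.prod_congr rfl fun A hA => ?_
      rw [map_prod]
      refine Finset.prod_congr rfl fun b hb => ?_
      have hlt := forall_lt_of_subset_Icc_succ (h.filter_notMem.subset_Icc A hA)
      beta_reduce
      rw [eigenvalue_insert_right hW (fun j hj => hlt j (Finset.mem_filter.1 hj).1) (by simp)]
      simp only [coe_compRingHom_apply, sub_comp, X_comp, C_comp, C_add]
      ring
    have hc2 : P₂.comp (X - C a) = criticalProd (p + 1) (link p 𝓕)
        fun S T => X - C (eigenvalue c W (insert p S) (insert p T)) := by
      rw [hP₂, ← coe_compRingHom_apply, criticalProd, map_prod]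
      refine Finset.prod_congr rfl fun A hA => ?_
      rw [map_prod]
      refine Finset.prod_congr rfl fun b hb => ?_
      have hlt := forall_lt_of_subset_Icc_succ (h.link_family.subset_Icc A hA)
      have hS : ∀ j ∈ A.filter (· < b), p < j := fun j hj => hlt j (Finset.mem_filter.1 hj).1
      beta_reduce
      rw [eigenvalue_insert_left hW hS, eigenvalue_insert_right (W := raise W) (fun i j => hW _ _) hS (by simp)]
      -- For the link the translation is `(a / W 2 p) * W 2 p = a`, the same as for the deletion.
      · have e1 : raise W 1 p = W 2 p := rfl
        rw [e1, div_mul_cancel₀ _ (hW 2 p)]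
        simp only [coe_compRingHom_apply, sub_comp, X_comp, C_comp, C_add]
        ring
      · intro j hj
        rcases Finset.mem_insert.1 hj with rfl | hj
        · exact le_rfl
        · have := (Finset.mem_Icc.1 hj).1; omega
    rw [h.criticalProd_eq, eigenvalue_empty_singleton, ← ha, ← hc1, ← hc2]
    simp only [mul_comp, pow_comp, X_comp] at key
    refine mul_right_cancel₀ (pow_ne_zero m' (X_sub_C_ne_zero a)) ?_
    rw [key]
    -- The zero eigenvalues of `A A'` and `E` have been translated to `a`. Cancelling `m'` of them
    -- leaves `e`, one for each critical pair that moves `p`.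
    have hpow : (X - C a) ^ (e + r2) * (X - C a) ^ m0 =
        (X - C a) ^ e * (X - C a) ^ m' := by
      rw [← pow_add, ← pow_add]
      congr 1
      omega
    linear_combination X ^ n' * P₁.comp (X - C a) * P₂.comp (X - C a) * hpow

/-- The determinant of `1 + L` for the weighted Laplacian `L` of a shifted family. -/
theorem det_one_add_laplacian (h : IsShiftedFamily p q 𝓕) (c : K) {W : ℤ → ℤ → K}
    (hW : ∀ i j, W i j ≠ 0) :
    (1 + laplacian (Finset.Icc p q) c W 𝓕).det =
      criticalProd p 𝓕 fun S T => 1 + eigenvalue c W S T := by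
  rw [det_one_add_eq_charpoly, h.charpoly_laplacian c hW, eval_mul, eval_pow, eval_X,
    Fintype.card_coe, card_eq_card_link_add_card_filter p 𝓕, pow_add]
  -- One sign comes out per critical pair, hence one per link member by `criticalProd_const`; the
  -- global sign and the power of `-1` from the zero eigenvalues cancel these.
  have h1 : eval (-1) (criticalProd p 𝓕 fun S T => X - C (eigenvalue c W S T)) =
      criticalProd p 𝓕 (fun S T => (-1 : K)) *
        criticalProd p 𝓕 fun S T => 1 + eigenvalue c W S T := by
    simp only [criticalProd, eval_prod, ← Finset.prod_mul_distrib]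
    refine Finset.prod_congr rfl fun A _ => Finset.prod_congr rfl fun a _ => ?_
    simp; ring
  rw [h1, h.criticalProd_const]
  have h2 : ∀ k : ℕ, ((-1 : K) ^ k) * (-1) ^ k = 1 := fun k => by
    rw [← mul_pow]; simp
  generalize (criticalProd p 𝓕 fun S T => 1 + eigenvalue c W S T) = y
  have h3 := h2 (link p 𝓕).card
  have h4 := h2 (𝓕.filter (p ∉ ·)).card
  linear_combination (((-1) ^ (𝓕.filter (p ∉ ·)).card) ^ 2 * y) * h3 + y * h4

end IsShiftedFamily

end Spectrum

/-! ### Homology of shifted complexes -/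

theorem mem_facesOfDim {K : Finset (Finset ℤ)} {i : ℤ} {F : Finset ℤ} :
    F ∈ facesOfDim K i ↔ F ∈ K ∧ (F.card : ℤ) = i + 1 := Finset.mem_filter

theorem mem_chains {K : Finset (Finset ℤ)} {i : ℤ} {c : Finset ℤ →₀ ℤ} :
    c ∈ chains K i ↔ c.support ⊆ facesOfDim K i := by
  rw [chains, Finsupp.mem_supported, Finset.coe_subset]

theorem eq_zero_of_mem_chains {K : Finset (Finset ℤ)} {i : ℤ} {c : Finset ℤ →₀ ℤ}
    (hc : c ∈ chains K i) {F : Finset ℤ} (hF : F ∉ facesOfDim K i) : c F = 0 := by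
  by_contra h
  exact hF (mem_chains.1 hc (Finsupp.mem_support_iff.2 h))

instance finite_chains (K : Finset (Finset ℤ)) (i : ℤ) : Module.Finite ℤ (chains K i) :=
  Module.Finite.equiv (Finsupp.supportedEquivFinsupp (M := ℤ) (R := ℤ)
    (facesOfDim K i : Set (Finset ℤ))).symm

instance finite_cycles (K : Finset (Finset ℤ)) (i : ℤ) : Module.Finite ℤ (cycles K i) := by
  have h1 : IsNoetherian ℤ (chains K i) := isNoetherian_of_isNoetherianRing_of_finite ℤ _
  have h2 : IsNoetherian ℤ (cycles K i) := isNoetherian_of_le inf_le_left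
  infer_instance

theorem card_erase_of_mem_facesOfDim {K : Finset (Finset ℤ)} {i : ℤ} {F : Finset ℤ}
    (hF : F ∈ facesOfDim K (i + 1)) {j : ℤ} (hj : j ∈ F) : ((F.erase j).card : ℤ) = i + 1 := by
  have h1 := (mem_facesOfDim.1 hF).2
  have h2 := Finset.card_erase_add_one hj
  omega

theorem IsComplexOn.erase_mem_facesOfDim {V : Finset ℤ} {K : Finset (Finset ℤ)}
    (hK : IsComplexOn V K) {i : ℤ} {F : Finset ℤ} (hF : F ∈ facesOfDim K (i + 1)) {j : ℤ}
    (hj : j ∈ F) : F.erase j ∈ facesOfDim K i :=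
  mem_facesOfDim.2 ⟨hK.down_closed F (mem_facesOfDim.1 hF).1 _ (Finset.erase_subset _ _),
    card_erase_of_mem_facesOfDim hF hj⟩

theorem IsComplexOn.boundary_mem_chains {V : Finset ℤ} {K : Finset (Finset ℤ)}
    (hK : IsComplexOn V K) {i : ℤ} {c : Finset ℤ →₀ ℤ} (hc : c ∈ chains K (i + 1)) :
    boundary c ∈ chains K i := by
  rw [mem_chains]
  intro G hG
  rw [Finsupp.mem_support_iff, boundary_apply_eq_sum (mem_chains.1 hc)] at hG
  obtain ⟨F, hF, h⟩ := Finset.exists_ne_zero_of_sum_ne_zero hG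
  obtain ⟨j, hj, rfl⟩ := exists_erase_of_incidence_ne_zero (right_ne_zero_of_mul h)
  exact hK.erase_mem_facesOfDim hF hj

/-- In a shifted complex without `i`-dimensional rational homology, the cone from the initial
vertex over an `i`-dimensional face is a face. -/
theorem insert_mem_of_betti_eq_zero {p q : ℤ} {K : Finset (Finset ℤ)}
    (hK : IsComplexOn (Finset.Icc p q) K) (hshift : IsShifted p q K) {i : ℤ}
    (hb : betti K i = 0) {G : Finset ℤ} (hG : G ∈ facesOfDim K i) (hp : p ∉ G) :
    insert p G ∈ K := by
  by_contra hn
  obtain ⟨hGK, hGc⟩ := mem_facesOfDim.1 hG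
  have hlt : ∀ j ∈ G, p < j :=
    forall_lt_of_subset_Icc_succ (subset_Icc_succ (hK.subset_vertices G hGK) hp)
  -- Even when the cone is missing from `K`, its facets are present: `G` itself, and the sets
  -- obtained from `G` by shifting a vertex to `p`.
  have hz : boundary (Finsupp.single (insert p G) 1) ∈ cycles K i := by
    refine ⟨mem_chains.2 fun H hH => ?_, boundary_boundary _⟩
    rw [Finsupp.mem_support_iff] at hH
    obtain ⟨j, hj, rfl⟩ := exists_erase_of_incidence_ne_zero hH
    rcases Finset.mem_insert.1 hj with rfl | hj
    · rwa [Finset.erase_insert hp]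
    · have hjp := hlt j hj
      have h1 := Finset.mem_Icc.1 (hK.subset_vertices G hGK hj)
      rw [Finset.erase_insert_of_ne (by omega), mem_facesOfDim]
      refine ⟨hshift p (by simp; omega) j (by simp; omega) hjp G hGK hp hj, ?_⟩
      rw [Finset.card_insert_of_notMem (fun h => hp (Finset.mem_of_mem_erase h)),
        Finset.card_erase_add_one hj, hGc]
  -- Rank zero only makes the class torsion, so a nonzero multiple `a` of the cycle bounds; its
  -- coefficient at `G` is `a`.
  have ht := Module.finrank_eq_zero_iff_isTorsion.1 hb
  obtain ⟨a, ha⟩ := @ht (Submodule.Quotient.mk ⟨_, hz⟩)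
  have ha' : Submodule.Quotient.mk (p := (boundaries K i).submoduleOf (cycles K i))
      ((a : ℤ) • ⟨_, hz⟩) = 0 := ha
  rw [Submodule.Quotient.mk_eq_zero] at ha'
  obtain ⟨c, hc, hca⟩ := ha'
  have h1 := DFunLike.congr_fun hca G
  have h2 : ((a : ℤ) • boundary (Finsupp.single (insert p G) 1)) G = a := by
    change (a : ℤ) * incidence G (insert p G) = a
    rw [incidence_insert_right hlt hp, if_pos rfl, mul_one]
  have h3 : boundary c G = 0 := by
    -- No face of dimension `i + 1` contains `G`: shifting its extra vertex to `p` would put the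
    -- missing cone in `K`. So every boundary vanishes at `G`.
    rw [boundary_apply_eq_sum (mem_chains.1 hc)]
    refine Finset.sum_eq_zero fun F hF => ?_
    by_contra h
    obtain ⟨j, hj, rfl⟩ := exists_erase_of_incidence_ne_zero (right_ne_zero_of_mul h)
    have hFK := (mem_facesOfDim.1 hF).1
    have h4 := Finset.mem_Icc.1 (hK.subset_vertices F hFK hj)
    have hjp : j ≠ p := by
      rintro rfl
      rw [Finset.insert_erase hj] at hn
      exact hn hFK
    refine hn (hshift p (by simp; omega) j (by simp; omega) (by omega) F hFK (fun h => hp ?_) hj)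
    exact Finset.mem_erase.2 ⟨hjp.symm, h⟩
  have h5 : (a : ℤ) = 0 := by rw [← h2, ← h3]; exact h1.symm
  exact nonZeroDivisors.coe_ne_zero a h5

/-- A chain with prescribed coefficients. -/
theorem exists_mem_chains {K : Finset (Finset ℤ)} {i : ℤ} {ι : Type*} (e : ι ≃ facesOfDim K i)
    (v : ι → ℤ) : ∃ c ∈ chains K i, ∀ a, c (e a) = v a := by
  classical
  refine ⟨Finsupp.onFinset (facesOfDim K i)
    (fun F => if h : F ∈ facesOfDim K i then v (e.symm ⟨F, h⟩) else 0) ?_, ?_, ?_⟩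
  · intro F h
    by_contra h'
    simp [h'] at h
  · rw [mem_chains]
    exact Finsupp.support_onFinset_subset
  · intro a
    simp

theorem ext_of_mem_chains {K : Finset (Finset ℤ)} {i : ℤ} {ι : Type*}
    (e : ι ≃ facesOfDim K i) {c c' : Finset ℤ →₀ ℤ} (hc : c ∈ chains K i) (hc' : c' ∈ chains K i)
    (h : ∀ a, c (e a) = c' (e a)) : c = c' := by
  ext F
  by_cases hF : F ∈ facesOfDim K i
  · simpa using h (e.symm ⟨F, hF⟩)
  · rw [eq_zero_of_mem_chains hc hF, eq_zero_of_mem_chains hc' hF]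

/-- The chain group as a space of functions on the faces. -/
def chainsEquiv (K : Finset (Finset ℤ)) (i : ℤ) {ι : Type*} (e : ι ≃ facesOfDim K i) :
    chains K i ≃ₗ[ℤ] (ι → ℤ) :=
  LinearEquiv.ofBijective
    { toFun := fun c a => c.1 (e a)
      map_add' := fun _ _ => rfl
      map_smul' := fun _ _ => rfl } <| by
    constructor
    · intro c c' h
      exact Subtype.ext (ext_of_mem_chains e c.2 c'.2 fun a => congrFun h a)
    · intro v
      obtain ⟨c, hc, h⟩ := exists_mem_chains e v
      exact ⟨⟨c, hc⟩, funext h⟩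

/-- The rows indexed by the link of the boundary matrix with columns indexed by `ι`. -/
def linkBoundary (p d : ℤ) (K : Finset (Finset ℤ)) {ι : Type*} (σ : ι → Finset ℤ) :
    Matrix (facesOfDim (link p K) (d - 1)) ι ℤ :=
  of fun G a => incidence G (σ a)

theorem linkBoundary_mulVec {p d : ℤ} {K U : Finset (Finset ℤ)} {i : ℤ} {ι : Type*} [Fintype ι]
    (e : ι ≃ facesOfDim U i) {c : Finset ℤ →₀ ℤ} (hc : c ∈ chains U i)
    (G : facesOfDim (link p K) (d - 1)) :
    (linkBoundary p d K (fun a => (e a : Finset ℤ)) *ᵥ fun a => c (e a)) G = boundary c G := by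
  rw [boundary_apply_eq_sum (mem_chains.1 hc), ← Finset.sum_coe_sort, ← e.sum_comp]
  exact Finset.sum_congr rfl fun a _ => mul_comm _ _

/-- A complex on `[p,q]` of dimension at most `d` such that the cone with apex `p` over every face of
dimension `d - 1` avoiding `p` is a face. -/
structure IsConeLike (p q d : ℤ) (K : Finset (Finset ℤ)) : Prop where
  isComplexOn : IsComplexOn (Finset.Icc p q) K
  card_le : ∀ F ∈ K, (F.card : ℤ) ≤ d + 1
  insert_mem : ∀ G ∈ facesOfDim K (d - 1), p ∉ G → insert p G ∈ K

/-! ### Homology of cone-like complexes in degrees `d` and `d - 1` -/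

namespace IsConeLike

variable {p q d : ℤ} {K : Finset (Finset ℤ)}

theorem mem_link_iff (h : IsConeLike p q d K) {G : Finset ℤ} :
    G ∈ facesOfDim (link p K) (d - 1) ↔ G ∈ facesOfDim K (d - 1) ∧ p ∉ G := by
  rw [mem_facesOfDim, mem_link]
  constructor
  · rintro ⟨⟨h1, h2⟩, h3⟩
    exact ⟨mem_facesOfDim.2 ⟨h.isComplexOn.down_closed _ h2 _ (Finset.subset_insert _ _), h3⟩, h1⟩
  · rintro ⟨h1, h2⟩
    exact ⟨⟨h2, h.insert_mem G h1 h2⟩, (mem_facesOfDim.1 h1).2⟩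

theorem lt_of_mem (h : IsConeLike p q d K) {G : Finset ℤ} (hG : G ∈ K) (hp : p ∉ G) :
    ∀ j ∈ G, p < j :=
  forall_lt_of_subset_Icc_succ (subset_Icc_succ (h.isComplexOn.subset_vertices G hG) hp)

/-- A cycle of codimension one is determined by its coefficients on the link. -/
theorem eq_zero_of_cycle (h : IsConeLike p q d K) {z : Finset ℤ →₀ ℤ}
    (hz : z ∈ cycles K (d - 1)) (h0 : ∀ G ∈ facesOfDim (link p K) (d - 1), z G = 0) : z = 0 := by
  have h0' : ∀ F, p ∉ F → z F = 0 := by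
    intro F hp
    by_cases hF : F ∈ facesOfDim K (d - 1)
    · exact h0 F (h.mem_link_iff.2 ⟨hF, hp⟩)
    · exact eq_zero_of_mem_chains hz.1 hF
  ext F
  rw [Finsupp.zero_apply]
  by_cases hp : p ∈ F
  swap
  · exact h0' F hp
  by_cases hF : F ∈ facesOfDim K (d - 1)
  swap
  · exact eq_zero_of_mem_chains hz.1 hF
  -- The surviving support consists of cones, and `F` is the only cone having `F.erase p` as its
  -- facet opposite `p`; hence this boundary coefficient is `z F`.
  have h1 : boundary z (F.erase p) = 0 := by rw [LinearMap.mem_ker.1 hz.2]; rfl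
  rw [boundary_apply_eq_sum (mem_chains.1 hz.1), Finset.sum_eq_single_of_mem F hF] at h1
  · have hlt := h.lt_of_mem (h.isComplexOn.down_closed F (mem_facesOfDim.1 hF).1 _
      (Finset.erase_subset p F)) (Finset.notMem_erase p F)
    have h2 := incidence_insert_right hlt (Finset.notMem_erase p F)
    rw [if_pos rfl, Finset.insert_erase hp] at h2
    rwa [h2, mul_one] at h1
  · intro F' hF' hne
    by_cases hp' : p ∈ F'
    · have hlt := h.lt_of_mem (h.isComplexOn.down_closed F' (mem_facesOfDim.1 hF').1 _
        (Finset.erase_subset p F')) (Finset.notMem_erase p F')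
      have h2 := incidence_insert_right hlt (Finset.notMem_erase p F)
      rw [Finset.insert_erase hp', if_neg] at h2
      · rw [h2, mul_zero]
      · intro h3
        apply hne
        rw [← Finset.insert_erase hp', ← h3, Finset.insert_erase hp]
    · rw [h0' F' hp', zero_mul]

theorem insert_mem_facesOfDim {G : Finset ℤ} (hG : G ∈ facesOfDim (link p K) (d - 1)) :
    insert p G ∈ facesOfDim K d := by
  obtain ⟨h1, h2⟩ := mem_facesOfDim.1 hG
  obtain ⟨h3, h4⟩ := mem_link.1 h1
  rw [mem_facesOfDim, Finset.card_insert_of_notMem h3]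
  exact ⟨h4, by push_cast; omega⟩

/-- Every function on the link is the restriction of the boundary of a top-dimensional chain. -/
theorem exists_boundary (h : IsConeLike p q d K) (v : facesOfDim (link p K) (d - 1) → ℤ) :
    ∃ c ∈ chains K d, ∀ G : facesOfDim (link p K) (d - 1), boundary c G = v G := by
  -- The only facet of a cone that avoids `p` is its base, so cones act as a dual basis on the link.
  refine ⟨∑ G, v G • Finsupp.single (insert p G.1) (1 : ℤ), ?_, ?_⟩
  · refine Submodule.sum_mem _ fun G _ => Submodule.smul_mem _ _ ?_
    exact Finsupp.single_mem_supported ℤ _ (insert_mem_facesOfDim G.2)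
  · intro G
    rw [map_sum, Finsupp.finsetSum_apply, Finset.sum_eq_single_of_mem G (Finset.mem_univ _)]
    · have hG := h.mem_link_iff.1 G.2
      rw [map_smul, Finsupp.smul_apply]
      change v G * incidence G (insert p G) = v G
      rw [incidence_insert_right (h.lt_of_mem (mem_facesOfDim.1 hG.1).1 hG.2) hG.2, if_pos rfl,
        mul_one]
    · intro G' _ hne
      have hG' := h.mem_link_iff.1 G'.2
      rw [map_smul, Finsupp.smul_apply]
      change v G' * incidence G (insert p G') = 0
      rw [incidence_insert_right (h.lt_of_mem (mem_facesOfDim.1 hG'.1).1 hG'.2)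
        (h.mem_link_iff.1 G.2).2, if_neg (fun h' => hne (Subtype.ext h'.symm)), mul_zero]

variable {U : Finset (Finset ℤ)}

/-- The coefficients of a cycle of codimension one on the link. -/
def cyclesRestrict (p d : ℤ) (K U : Finset (Finset ℤ)) :
    cycles U (d - 1) →ₗ[ℤ] (facesOfDim (link p K) (d - 1) → ℤ) where
  toFun z G := z.1 G
  map_add' _ _ := rfl
  map_smul' _ _ := rfl

/-- The cycles of codimension one are freely parametrized by their coefficients on the link. -/
def cyclesEquiv (h : IsConeLike p q d K) (hU : facesOfDim U (d - 1) = facesOfDim K (d - 1)) :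
    cycles U (d - 1) ≃ₗ[ℤ] (facesOfDim (link p K) (d - 1) → ℤ) :=
  have hcyc : cycles U (d - 1) = cycles K (d - 1) := by rw [cycles, cycles, chains, chains, hU]
  LinearEquiv.ofBijective (cyclesRestrict p d K U) <| by
    constructor
    · rw [← LinearMap.ker_eq_bot, LinearMap.ker_eq_bot']
      rintro ⟨z, hz⟩ h0
      exact Subtype.ext (h.eq_zero_of_cycle (hcyc ▸ hz) fun G hG => congrFun h0 ⟨G, hG⟩)
    · intro v
      obtain ⟨c, hc, hv⟩ := h.exists_boundary v
      rw [← sub_add_cancel d 1] at hc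
      refine ⟨⟨boundary c, ?_⟩, funext hv⟩
      rw [hcyc]
      exact ⟨h.isComplexOn.boundary_mem_chains hc, boundary_boundary c⟩

/-- In the coordinates of `cyclesEquiv`, the boundaries are the integer column span of the reduced
boundary matrix. -/
theorem map_boundaries (h : IsConeLike p q d K) (hUc : IsComplexOn (Finset.Icc p q) U)
    (hU : facesOfDim U (d - 1) = facesOfDim K (d - 1)) {ι : Type*} [Fintype ι]
    (e : ι ≃ facesOfDim U d) :
    ((boundaries U (d - 1)).submoduleOf (cycles U (d - 1))).map (h.cyclesEquiv hU).toLinearMap =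
      LinearMap.range (linkBoundary p d K (fun a => (e a : Finset ℤ))).mulVecLin := by
  have hd : d - 1 + 1 = d := sub_add_cancel d 1
  ext v
  rw [Submodule.mem_map, LinearMap.mem_range]
  constructor
  · rintro ⟨z, ⟨c, hc, hcz⟩, rfl⟩
    rw [hd] at hc
    refine ⟨fun a => c (e a), ?_⟩
    ext G
    rw [mulVecLin_apply, linkBoundary_mulVec e hc, hcz]
    rfl
  · rintro ⟨w, rfl⟩
    obtain ⟨c, hc, hcw⟩ := exists_mem_chains e w
    have hc' : c ∈ chains U (d - 1 + 1) := by rwa [hd]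
    refine ⟨⟨boundary c, hUc.boundary_mem_chains hc', boundary_boundary c⟩, ⟨c, hc', rfl⟩, ?_⟩
    ext G
    rw [mulVecLin_apply, ← funext hcw, linkBoundary_mulVec e hc]
    rfl

/-- The homology of codimension one is the cokernel of a reduced boundary matrix. -/
def homologyEquiv (h : IsConeLike p q d K) (hUc : IsComplexOn (Finset.Icc p q) U)
    (hU : facesOfDim U (d - 1) = facesOfDim K (d - 1)) {ι : Type*} [Fintype ι]
    (e : ι ≃ facesOfDim U d) :
    Homology U (d - 1) ≃ₗ[ℤ] (facesOfDim (link p K) (d - 1) → ℤ) ⧸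
      LinearMap.range (linkBoundary p d K (fun a => (e a : Finset ℤ))).mulVecLin :=
  Submodule.Quotient.equiv _ _ (h.cyclesEquiv hU) (h.map_boundaries hUc hU e)

theorem facesOfDim_succ_eq_empty (h : IsConeLike p q d K) (hUK : U ⊆ K) :
    facesOfDim U (d + 1) = ∅ := by
  refine Finset.eq_empty_of_forall_notMem fun F hF => ?_
  obtain ⟨h1, h2⟩ := mem_facesOfDim.1 hF
  have := h.card_le F (hUK h1)
  omega

theorem boundaries_eq_bot (h : IsConeLike p q d K) (hUK : U ⊆ K) : boundaries U d = ⊥ := by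
  rw [boundaries, chains, h.facesOfDim_succ_eq_empty hUK]
  simp

/-- A top-dimensional chain is a cycle when its boundary vanishes on the link. -/
theorem mem_cycles_iff (h : IsConeLike p q d K) (hUK : U ⊆ K) {c : Finset ℤ →₀ ℤ}
    (hc : c ∈ chains U d) :
    c ∈ cycles U d ↔ ∀ G : facesOfDim (link p K) (d - 1), boundary c G = 0 := by
  constructor
  · intro hcyc G
    rw [LinearMap.mem_ker.1 hcyc.2]; rfl
  · intro h0
    refine ⟨hc, LinearMap.mem_ker.2 (h.eq_zero_of_cycle ⟨?_, boundary_boundary c⟩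
      fun G hG => h0 ⟨G, hG⟩)⟩
    refine h.isComplexOn.boundary_mem_chains (i := d - 1) ?_
    rw [sub_add_cancel]
    refine mem_chains.2 ((mem_chains.1 hc).trans fun F hF => ?_)
    exact mem_facesOfDim.2 ⟨hUK (mem_facesOfDim.1 hF).1, (mem_facesOfDim.1 hF).2⟩

theorem submoduleOf_boundaries_eq_bot (h : IsConeLike p q d K) (hUK : U ⊆ K) :
    (boundaries U d).submoduleOf (cycles U d) = ⊥ := by
  rw [h.boundaries_eq_bot hUK, Submodule.submoduleOf, Submodule.comap_bot, Submodule.ker_subtype]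

theorem subsingleton_homology_iff_cycles (h : IsConeLike p q d K) (hUK : U ⊆ K) :
    Subsingleton (Homology U d) ↔ ∀ c ∈ cycles U d, c = 0 := by
  constructor
  · intro hs c hc
    have h1 := Subsingleton.elim
      (Submodule.Quotient.mk (p := (boundaries U d).submoduleOf (cycles U d)) ⟨c, hc⟩) 0
    rw [Submodule.Quotient.mk_eq_zero, h.submoduleOf_boundaries_eq_bot hUK,
      Submodule.mem_bot] at h1
    exact congrArg Subtype.val h1
  · intro h0
    have : Subsingleton (cycles U d) :=
      ⟨fun a b => Subtype.ext ((h0 a a.2).trans (h0 b b.2).symm)⟩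
    exact (Submodule.mkQ_surjective _).subsingleton

/-- With no faces above dimension `d`, top homology is the group of cycles, which is the kernel of
the reduced boundary matrix because a boundary vanishing on the link is zero. -/
theorem subsingleton_homology_iff (h : IsConeLike p q d K) (hUK : U ⊆ K)
    (e : facesOfDim (link p K) (d - 1) ≃ facesOfDim U d) :
    Subsingleton (Homology U d) ↔
      (linkBoundary p d K (fun a => (e a : Finset ℤ))).det ≠ 0 := by
  rw [h.subsingleton_homology_iff_cycles hUK, ne_eq, ← exists_mulVec_eq_zero_iff]
  constructor
  · rintro hs ⟨v, hv, hv0⟩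
    obtain ⟨c, hc, hcv⟩ := exists_mem_chains e v
    have hcyc : c ∈ cycles U d := by
      rw [h.mem_cycles_iff hUK hc]
      intro G
      rw [← linkBoundary_mulVec e hc, funext hcv, hv0]; rfl
    apply hv
    ext a
    rw [← hcv, hs c hcyc]; rfl
  · intro hn c hc
    by_contra hne
    refine hn ⟨fun a => c (e a), fun h0 => hne ?_, ?_⟩
    · exact ext_of_mem_chains e hc.1 (Submodule.zero_mem _) fun a => congrFun h0 a
    · ext G
      rw [linkBoundary_mulVec e hc.1]
      exact (h.mem_cycles_iff hUK hc.1).1 hc G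

/-- Rank–nullity for the boundary restricted to the link, which is surjective with the top cycles as
kernel. -/
theorem betti_eq (h : IsConeLike p q d K) :
    (betti K d : ℤ) = (facesOfDim K d).card - (facesOfDim (link p K) (d - 1)).card := by
  let ρ : (Finset ℤ →₀ ℤ) →ₗ[ℤ] (facesOfDim (link p K) (d - 1) → ℤ) :=
    { toFun := fun c G => boundary c G
      map_add' := fun c c' => by ext G; rw [map_add]; rfl
      map_smul' := fun a c => by ext G; rw [map_smul]; rfl }
  let φ := ρ.domRestrict (chains K d)
  have h1 : betti K d = Module.finrank ℤ (cycles K d) :=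
    (Submodule.quotEquivOfEqBot _ (h.submoduleOf_boundaries_eq_bot subset_rfl)).finrank_eq
  have h2 : LinearMap.ker φ = (cycles K d).submoduleOf (chains K d) := by
    ext c
    rw [LinearMap.mem_ker]
    change _ ↔ c.1 ∈ cycles K d
    rw [h.mem_cycles_iff subset_rfl c.2]
    exact ⟨fun h0 G => congrFun h0 G, fun h0 => funext h0⟩
  have h3 : Module.finrank ℤ (LinearMap.ker φ) = Module.finrank ℤ (cycles K d) := by
    rw [h2]
    exact (Submodule.submoduleOfEquivOfLe inf_le_left).finrank_eq
  have h4 : LinearMap.range φ = ⊤ := by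
    rw [LinearMap.range_eq_top]
    intro v
    obtain ⟨c, hc, hv⟩ := h.exists_boundary v
    exact ⟨⟨c, hc⟩, funext hv⟩
  have h5 := (LinearMap.ker φ).finrank_quotient_add_finrank
  rw [φ.quotKerEquivRange.finrank_eq, h4, finrank_top, h3, ← h1, (chainsEquiv K d (Equiv.refl _)).finrank_eq] at h5
  simp only [Module.finrank_fintype_fun_eq_card, Fintype.card_coe] at h5
  omega

end IsConeLike

/-! ### The weighted matrix-tree theorem for cone-like complexes -/

theorem mem_skeleton {K : Finset (Finset ℤ)} {i : ℤ} {F : Finset ℤ} :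
    F ∈ skeleton K i ↔ F ∈ K ∧ (F.card : ℤ) ≤ i + 1 := Finset.mem_filter

theorem facesOfDim_skeleton (K : Finset (Finset ℤ)) (i : ℤ) :
    facesOfDim (skeleton K i) i = facesOfDim K i := by
  ext F
  rw [mem_facesOfDim, mem_facesOfDim, mem_skeleton]
  constructor
  · rintro ⟨⟨h1, _⟩, h2⟩; exact ⟨h1, h2⟩
  · rintro ⟨h1, h2⟩; exact ⟨⟨h1, h2.le⟩, h2⟩

theorem facesOfDim_eq_of_skeleton_eq {K U : Finset (Finset ℤ)} {i : ℤ}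
    (h : skeleton U i = skeleton K i) : facesOfDim U i = facesOfDim K i := by
  rw [← facesOfDim_skeleton, h, facesOfDim_skeleton]

/-- The top-dimensional faces of a complex that belong to `U`. -/
def topFaces (d : ℤ) (K U : Finset (Finset ℤ)) : Finset (facesOfDim K d) :=
  Finset.univ.filter fun F => F.1 ∈ U

theorem mem_topFaces {d : ℤ} {K U : Finset (Finset ℤ)} {F : facesOfDim K d} :
    F ∈ topFaces d K U ↔ F.1 ∈ U := by simp [topFaces]

/-- The top-dimensional faces of a subcomplex. -/
def topFacesEquiv {d : ℤ} {K U : Finset (Finset ℤ)} (hUK : U ⊆ K) :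
    topFaces d K U ≃ facesOfDim U d where
  toFun F := ⟨F.1.1, mem_facesOfDim.2 ⟨mem_topFaces.1 F.2, (mem_facesOfDim.1 F.1.2).2⟩⟩
  invFun F := ⟨⟨F.1, mem_facesOfDim.2
    ⟨hUK (mem_facesOfDim.1 F.2).1, (mem_facesOfDim.1 F.2).2⟩⟩,
    mem_topFaces.2 (mem_facesOfDim.1 F.2).1⟩
  left_inv _ := rfl
  right_inv _ := rfl

/-- The codimension-one skeleton of `K` together with a set of top-dimensional faces. -/
def skeletonUnion (d : ℤ) (K : Finset (Finset ℤ)) (s : Finset (facesOfDim K d)) :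
    Finset (Finset ℤ) :=
  skeleton K (d - 1) ∪ s.map (Function.Embedding.subtype _)

theorem mem_skeletonUnion {d : ℤ} {K : Finset (Finset ℤ)} {s : Finset (facesOfDim K d)}
    {F : Finset ℤ} : F ∈ skeletonUnion d K s ↔
      F ∈ skeleton K (d - 1) ∨ ∃ h : F ∈ facesOfDim K d, ⟨F, h⟩ ∈ s := by
  simp [skeletonUnion]

theorem topFaces_skeletonUnion {d : ℤ} {K : Finset (Finset ℤ)} (s : Finset (facesOfDim K d)) :
    topFaces d K (skeletonUnion d K s) = s := by
  ext F
  rw [mem_topFaces, mem_skeletonUnion]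
  constructor
  · rintro (h | ⟨_, h⟩)
    · have h1 := (mem_skeleton.1 h).2
      have h2 := (mem_facesOfDim.1 F.2).2
      omega
    · exact h
  · exact fun h => Or.inr ⟨F.2, h⟩

/-! ### Spanning trees as nonsingular maximal minors -/

namespace IsConeLike

variable {p q d : ℤ} {K U : Finset (Finset ℤ)}

theorem skeletonUnion_subset (s : Finset (facesOfDim K d)) : skeletonUnion d K s ⊆ K := by
  intro F hF
  rcases mem_skeletonUnion.1 hF with h | ⟨h, _⟩
  · exact (mem_skeleton.1 h).1
  · exact (mem_facesOfDim.1 h).1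

theorem isComplexOn_skeletonUnion (h : IsConeLike p q d K) (hd : 0 ≤ d)
    (s : Finset (facesOfDim K d)) : IsComplexOn (Finset.Icc p q) (skeletonUnion d K s) where
  subset_vertices F hF := h.isComplexOn.subset_vertices F (skeletonUnion_subset s hF)
  empty_mem := mem_skeletonUnion.2 (Or.inl (mem_skeleton.2
    ⟨h.isComplexOn.empty_mem, by simpa using hd⟩))
  down_closed F hF G hGF := by
    rcases hGF.eq_or_ssubset with rfl | hlt
    · exact hF
    · have hFK := skeletonUnion_subset s hF
      have h1 := h.card_le F hFK
      have h2 := Finset.card_lt_card hlt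
      exact mem_skeletonUnion.2 (Or.inl (mem_skeleton.2
        ⟨h.isComplexOn.down_closed F hFK G hGF, by omega⟩))

theorem skeleton_skeletonUnion (s : Finset (facesOfDim K d)) :
    skeleton (skeletonUnion d K s) (d - 1) = skeleton K (d - 1) := by
  ext F
  rw [mem_skeleton]
  constructor
  · rintro ⟨h1, h2⟩
    exact mem_skeleton.2 ⟨skeletonUnion_subset s h1, h2⟩
  · intro h
    exact ⟨mem_skeletonUnion.2 (Or.inl h), (mem_skeleton.1 h).2⟩

theorem dim_eq (h : IsConeLike p q d K) (hUK : U ⊆ K) (hd : 0 ≤ d)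
    (hne : (facesOfDim U d).Nonempty) : dim U = d := by
  obtain ⟨F, hF⟩ := hne
  obtain ⟨h1, h2⟩ := mem_facesOfDim.1 hF
  have h3 : F.card ≤ U.sup Finset.card := Finset.le_sup h1
  have h4 : U.sup Finset.card ≤ (d + 1).toNat := Finset.sup_le fun G hG => by
    have := h.card_le G (hUK hG)
    omega
  rw [dim]
  omega

theorem natCard_homology (h : IsConeLike p q d K) (hUc : IsComplexOn (Finset.Icc p q) U)
    (hU : facesOfDim U (d - 1) = facesOfDim K (d - 1))
    (e : facesOfDim (link p K) (d - 1) ≃ facesOfDim U d)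
    (hdet : (linkBoundary p d K (fun a => (e a : Finset ℤ))).det ≠ 0) :
    Nat.card (Homology U (d - 1)) =
      (linkBoundary p d K (fun a => (e a : Finset ℤ))).det.natAbs := by
  rw [Nat.card_congr (h.homologyEquiv hUc hU e).toEquiv, natCard_quotient_range _ hdet]

/-- A nonsingular square submatrix of the reduced boundary matrix gives a spanning tree. -/
theorem isSpanningTree_skeletonUnion (h : IsConeLike p q d K) (hd : 0 ≤ d)
    (hb : betti K (d - 1) = 0) (hne : (facesOfDim (link p K) (d - 1)).Nonempty)
    (s : Finset (facesOfDim K d)) (e : facesOfDim (link p K) (d - 1) ≃ s)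
    (hdet : (linkBoundary p d K (fun a => ((e a).1 : Finset ℤ))).det ≠ 0) :
    IsSpanningTree (Finset.Icc p q) d K (skeletonUnion d K s) := by
  have hsub := skeletonUnion_subset (K := K) s
  let e' : facesOfDim (link p K) (d - 1) ≃ facesOfDim (skeletonUnion d K s) d :=
    e.trans ((Equiv.subtypeEquivRight (by rw [topFaces_skeletonUnion]; simp)).trans
      (topFacesEquiv hsub))
  have hfaces := facesOfDim_eq_of_skeleton_eq (skeleton_skeletonUnion (K := K) s)
  have hcomplex := h.isComplexOn_skeletonUnion hd s
  refine ⟨hcomplex, ?_, hsub, skeleton_skeletonUnion s, ?_, ?_, ?_⟩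
  · obtain ⟨G, hG⟩ := hne
    exact h.dim_eq hsub hd ⟨_, (e' ⟨G, hG⟩).2⟩
  · exact (h.subsingleton_homology_iff hsub e').2 hdet
  · refine Nat.finite_of_card_ne_zero ?_
    rw [h.natCard_homology hcomplex hfaces e' hdet]
    exact Int.natAbs_ne_zero.2 hdet
  · have := Fintype.card_congr e'
    simp only [Fintype.card_coe] at this
    rw [h.betti_eq, hb, ← this]
    push_cast
    ring

/-- The weighted matrix-tree theorem: the spanning tree enumerator is the determinant of the weighted
boundary Laplacian with rows and columns indexed by the link. -/
theorem tauHat_eq_det (k : Type*) [Field k] (h : IsConeLike p q d K) (hd : 0 ≤ d)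
    (hb : betti K (d - 1) = 0) (hne : (facesOfDim (link p K) (d - 1)).Nonempty) :
    tauHat k (Finset.Icc p q) d K =
      ((of fun (G : facesOfDim (link p K) (d - 1)) (F : facesOfDim K d) =>
          (incidence G F : RatFun k)) *
        of fun (F : facesOfDim K d) (G : facesOfDim (link p K) (d - 1)) =>
          Xmon k F.1.val * (incidence G F : RatFun k)).det := by
  classical
  rw [det_mul_eq_sum_powersetCard, tauHat]
  have hterm : ∀ (s : Finset (facesOfDim K d)) (e : facesOfDim (link p K) (d - 1) ≃ s),
      ((of fun (F : facesOfDim K d) (G : facesOfDim (link p K) (d - 1)) =>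
          Xmon k F.1.val * (incidence G F : RatFun k)).submatrix (Subtype.val : s → _) id *
        (of fun (G : facesOfDim (link p K) (d - 1)) (F : facesOfDim K d) =>
          (incidence G F : RatFun k)).submatrix id (Subtype.val : s → _)).det =
      (((linkBoundary p d K (fun a => ((e a).1 : Finset ℤ))).det : ℤ) : RatFun k) ^ 2 *
        ∏ F ∈ s, Xmon k F.1.val := by
    intro s e
    rw [det_mul_submatrix_of_equiv e.symm, Equiv.symm_symm]
    have hc : (((linkBoundary p d K (fun a => ((e a).1 : Finset ℤ))).det : ℤ) : RatFun k) =
        ((Int.castRingHom (RatFun k)).mapMatrix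
          (linkBoundary p d K (fun a => ((e a).1 : Finset ℤ)))).det :=
      (Int.castRingHom (RatFun k)).map_det _
    have h1 : (((of fun (G : facesOfDim (link p K) (d - 1)) (F : facesOfDim K d) =>
          (incidence G F : RatFun k)).submatrix id (Subtype.val : s → _)).submatrix id e).det =
        (((linkBoundary p d K (fun a => ((e a).1 : Finset ℤ))).det : ℤ) : RatFun k) := by
      rw [hc]
      rfl
    have h2 : (((of fun (F : facesOfDim K d) (G : facesOfDim (link p K) (d - 1)) =>
          Xmon k F.1.val * (incidence G F : RatFun k)).submatrix
          (Subtype.val : s → _) id).submatrix e id).det =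
        (∏ F ∈ s, Xmon k F.1.val) *
          (((linkBoundary p d K (fun a => ((e a).1 : Finset ℤ))).det : ℤ) : RatFun k) := by
      rw [← Finset.prod_coe_sort s, ← e.prod_comp, hc,
        ← det_transpose (RingHom.mapMatrix _ _), ← det_mul_column]
      rfl
    rw [h1, h2]
    ring
  -- The face count in the definition of a tree, together with `betti_eq`, makes the reduced
  -- boundary matrix square.
  have hcard : ∀ U, IsSpanningTree (Finset.Icc p q) d K U →
      (topFaces d K U).card = Fintype.card (facesOfDim (link p K) (d - 1)) := by
    intro U hU
    have h1 := Fintype.card_congr (topFacesEquiv (d := d) hU.subset)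
    have h2 := hU.count
    rw [h.betti_eq, hb] at h2
    simp only [Fintype.card_coe] at h1 ⊢
    push_cast at h2
    omega
  -- Trees share one skeleton, so their top faces determine them; a set of columns not arising from
  -- a tree has a singular minor and contributes zero.
  refine Finset.sum_of_injOn (topFaces d K) ?_ ?_ ?_ ?_
  · intro U hU U' hU' hUU'
    have key : ∀ U U', IsSpanningTree (Finset.Icc p q) d K U →
        IsSpanningTree (Finset.Icc p q) d K U' → topFaces d K U = topFaces d K U' → U ⊆ U' := by
      intro U U' hU hU' hUU' F hF
      have hFK := hU.subset hF
      have h1 := h.card_le F hFK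
      by_cases h2 : (F.card : ℤ) = d + 1
      · have h3 : (⟨F, mem_facesOfDim.2 ⟨hFK, h2⟩⟩ : facesOfDim K d) ∈ topFaces d K U :=
          mem_topFaces.2 hF
        rw [hUU'] at h3
        exact mem_topFaces.1 h3
      · have h3 : F ∈ skeleton U (d - 1) := mem_skeleton.2 ⟨hF, by omega⟩
        rw [hU.skeleton_eq, ← hU'.skeleton_eq] at h3
        exact (mem_skeleton.1 h3).1
    have h1 := (Finset.mem_filter.1 hU).2
    have h2 := (Finset.mem_filter.1 hU').2
    exact (key U U' h1 h2 hUU').antisymm (key U' U h2 h1 hUU'.symm)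
  · intro U hU
    rw [Finset.mem_coe, Finset.mem_powersetCard]
    exact ⟨Finset.subset_univ _, hcard U (Finset.mem_filter.1 hU).2⟩
  · intro s hs hs'
    obtain ⟨e⟩ : Nonempty (facesOfDim (link p K) (d - 1) ≃ s) := by
      rw [← Fintype.card_eq, (Fintype.card_coe s).trans (Finset.mem_powersetCard.1 hs).2]
    rw [hterm s e]
    by_cases hdet : (linkBoundary p d K (fun a => ((e a).1 : Finset ℤ))).det = 0
    · rw [hdet]; simp
    · refine absurd ⟨skeletonUnion d K s, ?_, topFaces_skeletonUnion s⟩ hs'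
      rw [Finset.mem_coe, spanningTrees, Finset.mem_filter, Finset.mem_powerset]
      exact ⟨skeletonUnion_subset s, h.isSpanningTree_skeletonUnion hd hb hne s e hdet⟩
  · intro U hU
    have hU' := (Finset.mem_filter.1 hU).2
    obtain ⟨e⟩ : Nonempty (facesOfDim (link p K) (d - 1) ≃ topFaces d K U) := by
      rw [← Fintype.card_eq, (Fintype.card_coe (topFaces d K U)).trans (hcard U hU')]
    rw [hterm _ e]
    let e' := e.trans (topFacesEquiv (d := d) hU'.subset)
    have hdet := (h.subsingleton_homology_iff hU'.subset e').1 hU'.acyclic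
    have h1 := h.natCard_homology hU'.isComplexOn
      (facesOfDim_eq_of_skeleton_eq hU'.skeleton_eq) e' hdet
    rw [h1]
    congr 1
    · rw [← Int.cast_natCast, Int.natCast_natAbs, ← Int.cast_pow, sq_abs, Int.cast_pow]
      rfl
    · rw [← Finset.prod_coe_sort, ← Finset.prod_coe_sort (topFaces d K U),
        ← (topFacesEquiv hU'.subset).prod_comp]
      rfl

end IsConeLike

/-! ### The spanning tree enumerator of a shifted complex -/

section Xvar

variable (k : Type*) [Field k]

theorem Xvar_ne_zero (i j : ℤ) : Xvar k i j ≠ 0 := by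
  refine pow_ne_zero 2 ?_
  rw [xvar, ne_eq, FaithfulSMul.algebraMap_eq_zero_iff]
  exact MvPolynomial.X_ne_zero _

/-- Squaring is multiplicative, so it can be applied variable by variable. -/
theorem Xmon_eq_weight (S : Multiset ℤ) : Xmon k S = weight (Xvar k) S :=
  map_weight (powMonoidHom 2 : RatFun k →* RatFun k) (xvar k) S

theorem raising_Xvar (i j : ℤ) : raising k (Xvar k i j) = raise (Xvar k) i j := by
  rw [Xvar, map_pow, xvar, raising, IsFractionRing.ringEquivOfRingEquiv_algebraMap]
  simp [raise, Xvar, xvar]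

theorem raising_Xmon (S : Multiset ℤ) : raising k (Xmon k S) = weight (raise (Xvar k)) S := by
  rw [Xmon_eq_weight, map_weight]
  simp only [raising_Xvar]

end Xvar

/-- Reduction of the weighted boundary Laplacian to the deletion of the initial vertex. -/
theorem IsShiftedFamily.det_reduced_laplacian {K : Type*} [Field K] {p q : ℤ}
    {𝓕 : Finset (Finset ℤ)} (h : IsShiftedFamily p q 𝓕) {W : ℤ → ℤ → K}
    (hW : ∀ i j, W i j ≠ 0) :
    ((of fun (G : link p 𝓕) (F : 𝓕) => (incidence G F : K)) *
        of fun (F : 𝓕) (G : link p 𝓕) => weight W F.1.val * (incidence G F : K)).det =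
      (∏ G ∈ link p 𝓕, weight W (insert p G).val) *
        criticalProd (p + 1) (𝓕.filter (p ∉ ·))
          fun S T => eigenvalue (W 1 p)⁻¹ W S (insert p T) := by
  have hlt : ∀ G : link p 𝓕, ∀ j ∈ G.1, p < j := fun G =>
    forall_lt_of_subset_Icc_succ (h.link_family.subset_Icc _ G.2)
  -- Cone columns contribute the diagonal matrix alone. The constant `(W 1 p)⁻¹` is forced by `W_{G
  -- ∪ p} = W 1 p * ↑W_G`, which cancels the denominators of `linkCoincidence`.
  have hmat : ((of fun (G : link p 𝓕) (F : 𝓕) => (incidence G F : K)) *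
        of fun (F : 𝓕) (G : link p 𝓕) => weight W F.1.val * (incidence G F : K)) =
      (1 + linkIncidence K p 𝓕 * linkCoincidence p (W 1 p)⁻¹ W 𝓕) *
        diagonal fun G : link p 𝓕 => weight W (insert p G.1).val := by
    ext G G'
    rw [Matrix.mul_apply, mul_diagonal, Matrix.add_apply, Matrix.mul_apply,
      ← (linkSumEquiv p 𝓕).sum_comp, Fintype.sum_sum_type, add_mul, Finset.sum_mul]
    congr 1
    · rw [Finset.sum_eq_single_of_mem G' (Finset.mem_univ _)]
      · have hp := notMem_of_forall_lt (hlt G)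
        have hp' := notMem_of_forall_lt (hlt G')
        simp only [of_apply, coe_linkSumEquiv_inl, incidence_insert_right (hlt G') hp,
          incidence_insert_right (hlt G') hp', if_true, Int.cast_one, mul_one]
        by_cases hG : G = G'
        · subst hG; simp
        · have : (G : Finset ℤ) ≠ G' := fun h' => hG (Subtype.ext h')
          simp [hG, this]
      · intro H _ hne
        have : (G' : Finset ℤ) ≠ H := fun h' => hne (Subtype.ext h'.symm)
        simp only [of_apply, coe_linkSumEquiv_inl,
          incidence_insert_right (hlt H) (notMem_of_forall_lt (hlt G')), if_neg this]
        simp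
    · refine Finset.sum_congr rfl fun F _ => ?_
      have h1 : weight (raise W) G'.1.val ≠ 0 := weight_ne_zero (fun i j => hW _ _) _
      have h2 := hW 1 p
      simp only [of_apply, coe_linkSumEquiv_inr, linkIncidence, linkCoincidence,
        weight_insert W (hlt G')]
      field_simp
  rw [hmat, det_mul, det_diagonal, det_one_add_mul_comm, h.linkCoincidence_mul_linkIncidence,
    h.filter_notMem.det_one_add_laplacian _ hW, mul_comm,
    Finset.prod_coe_sort (link p 𝓕) (fun G => weight W (insert p G).val)]
  congr 1
  refine Finset.prod_congr rfl fun A hA => Finset.prod_congr rfl fun a _ => ?_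
  have hA' := forall_lt_of_subset_Icc_succ (h.filter_notMem.subset_Icc A hA)
  beta_reduce
  -- With this constant, adjoining `p` to `T` adds exactly `1`.
  rw [eigenvalue_insert_right hW (fun j hj => hA' j (Finset.mem_filter.1 hj).1) (by simp),
    inv_mul_cancel₀ (hW 1 p), add_comm]

theorem initialVertex_eq {p q : ℤ} {𝓕 : Finset (Finset ℤ)} (h : IsShiftedFamily p q 𝓕)
    {F : Finset ℤ} (hF : F ∈ 𝓕) (hne : F.Nonempty) : initialVertex 𝓕 = p := by
  have hmem : ∃ F ∈ 𝓕, p ∈ F := by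
    by_cases hp : p ∈ F
    · exact ⟨F, hF, hp⟩
    · obtain ⟨j, hj⟩ := hne
      have h1 := Finset.mem_Icc.1 (h.subset_Icc F hF hj)
      have h2 : j ≠ p := fun h => hp (h ▸ hj)
      exact ⟨_, h.isShifted p (by simp; omega) j (by simp; omega) (by omega) F hF hp hj,
        Finset.mem_insert_self _ _⟩
  refine IsLeast.csInf_eq ⟨hmem, ?_⟩
  rintro v ⟨G, hG, hv⟩
  exact (Finset.mem_Icc.1 (h.subset_Icc G hG hv)).1

theorem prod_longSignatures {p q : ℤ} {𝓕 : Finset (Finset ℤ)} (h : IsShiftedFamily p q 𝓕)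
    (hne : ∀ F ∈ 𝓕, F.Nonempty) {M : Type*} [CommMonoid M] (f : Finset ℤ × Finset ℤ → M) :
    ((longSignatures 𝓕).map f).prod = criticalProd p 𝓕 fun S T => f (S, T) := by
  rw [longSignatures, prod_criticalPairs]
  rcases 𝓕.eq_empty_or_nonempty with rfl | ⟨F, hF⟩
  -- For an empty family `initialVertex` is only a default value, but both products are empty.
  · rfl
  · rw [initialVertex_eq h hF (hne F hF)]

/-! ### Assembling the enumerator from the link and the deletion -/

section Faces

variable {p q d : ℤ} {K : Finset (Finset ℤ)}

theorem facesOfDim_del (hK : IsComplexOn (Finset.Icc p q) K) :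
    facesOfDim (del p K) d = (facesOfDim K d).filter (p ∉ ·) := by
  ext F
  rw [mem_facesOfDim, Finset.mem_filter, mem_facesOfDim, del, Finset.mem_image]
  constructor
  · rintro ⟨⟨G, hG, rfl⟩, h⟩
    exact ⟨⟨hK.down_closed G hG _ (Finset.erase_subset _ _), h⟩, Finset.notMem_erase _ _⟩
  · rintro ⟨⟨h1, h2⟩, h3⟩
    exact ⟨⟨F, h1, Finset.erase_eq_of_notMem h3⟩, h2⟩

theorem facesOfDim_link : facesOfDim (link p K) (d - 1) = link p (facesOfDim K d) := by
  ext F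
  rw [mem_facesOfDim, mem_link, mem_link, mem_facesOfDim]
  constructor
  · rintro ⟨⟨h1, h2⟩, h3⟩
    rw [Finset.card_insert_of_notMem h1]
    exact ⟨h1, h2, by push_cast; omega⟩
  · rintro ⟨h1, h2, h3⟩
    rw [Finset.card_insert_of_notMem h1] at h3
    push_cast at h3
    exact ⟨⟨h1, h2⟩, by omega⟩

theorem IsShifted.isShiftedFamily_facesOfDim (h : IsShifted p q K)
    (hK : IsComplexOn (Finset.Icc p q) K) : IsShiftedFamily p q (facesOfDim K d) where
  subset_Icc F hF := hK.subset_vertices F (mem_facesOfDim.1 hF).1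
  isShifted i hi j hj hij F hF hiF hjF := by
    obtain ⟨h1, h2⟩ := mem_facesOfDim.1 hF
    rw [mem_facesOfDim, Finset.card_insert_of_notMem (fun h => hiF (Finset.mem_of_mem_erase h)),
      Finset.card_erase_add_one hjF]
    exact ⟨h i hi j hj hij F h1 hiF hjF, h2⟩

/-- A top face contains `p` or can be shifted to contain it. This ensures that the complexes built
from nonsingular minors really have dimension `d`. -/
theorem link_facesOfDim_nonempty (h : IsShifted p q K) (hK : IsComplexOn (Finset.Icc p q) K)
    (hd : 0 ≤ d) (hdim : dim K = d) : (facesOfDim (link p K) (d - 1)).Nonempty := by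
  obtain ⟨F, hF, hF'⟩ := Finset.exists_mem_eq_sup K ⟨∅, hK.empty_mem⟩ Finset.card
  have hFd : F ∈ facesOfDim K d := by
    rw [mem_facesOfDim]
    rw [dim] at hdim
    exact ⟨hF, by omega⟩
  have hcard := (mem_facesOfDim.1 hFd).2
  rw [facesOfDim_link]
  by_cases hp : p ∈ F
  · exact ⟨F.erase p, mem_link.2 ⟨by simp, by rwa [Finset.insert_erase hp]⟩⟩
  · obtain ⟨j, hj⟩ : F.Nonempty := Finset.card_pos.1 (by omega)
    exact ⟨_, (h.isShiftedFamily_facesOfDim hK).erase_mem_link hFd hp hj⟩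

/-- Since `d ≥ 0` the faces are nonempty, so the initial vertex of a nonempty deletion is `p + 1`.
-/
theorem IsShifted.prod_longSignatures_del (h : IsShifted p q K)
    (hK : IsComplexOn (Finset.Icc p q) K) (hd : 0 ≤ d) {M : Type*} [CommMonoid M]
    (f : Finset ℤ × Finset ℤ → M) :
    ((longSignatures (facesOfDim (del p K) d)).map f).prod =
      criticalProd (p + 1) ((facesOfDim K d).filter (p ∉ ·)) fun S T => f (S, T) := by
  rw [facesOfDim_del hK]
  refine prod_longSignatures (h.isShiftedFamily_facesOfDim hK).filter_notMem
    (fun F hF => ?_) f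
  have := (mem_facesOfDim.1 (Finset.mem_filter.1 hF).1).2
  exact Finset.card_pos.1 (by omega)

/-- Signatures of the deletion lie strictly above `p`, so identities that need `p` to be least in `S
∪ p` and absent from `T` may be applied factor by factor. -/
theorem IsShifted.prod_longSignatures_del_congr (h : IsShifted p q K)
    (hK : IsComplexOn (Finset.Icc p q) K) (hd : 0 ≤ d) {M : Type*} [CommMonoid M]
    {f g : Finset ℤ × Finset ℤ → M}
    (hfg : ∀ S T : Finset ℤ, (∀ j ∈ S, p < j) → p ∉ T → f (S, T) = g (S, T)) :
    ((longSignatures (facesOfDim (del p K) d)).map f).prod =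
      ((longSignatures (facesOfDim (del p K) d)).map g).prod := by
  rw [h.prod_longSignatures_del hK hd, h.prod_longSignatures_del hK hd]
  refine Finset.prod_congr rfl fun A hA => Finset.prod_congr rfl fun a _ => ?_
  have hA' := (h.isShiftedFamily_facesOfDim hK).filter_notMem.subset_Icc A hA
  exact hfg _ _ (fun j hj => forall_lt_of_subset_Icc_succ hA' j (Finset.mem_filter.1 hj).1)
    (by simp)

/-- The spanning tree enumerator as a product over the eigenvalues of the weighted Laplacian. -/
theorem tauHat_eq_prod (k : Type*) [Field k] (hK : IsComplexOn (Finset.Icc p q) K)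
    (hshift : IsShifted p q K) (hd : 0 ≤ d) (hdim : dim K = d) (hAPC : IsAPC K) :
    tauHat k (Finset.Icc p q) d K =
      (∏ F ∈ facesOfDim (link p K) (d - 1), Xmon k (insert p F).val) *
        ((longSignatures (facesOfDim (del p K) d)).map fun ST =>
          eigenvalue (Xvar k 1 p)⁻¹ (Xvar k) ST.1 (insert p ST.2)).prod := by
  have hb : betti K (d - 1) = 0 := hAPC _ (by omega)
  have hcone : IsConeLike p q d K :=
    { isComplexOn := hK
      card_le := fun F hF => by
        have h1 : F.card ≤ K.sup Finset.card := Finset.le_sup hF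
        rw [dim] at hdim
        omega
      insert_mem := fun G hG hp => insert_mem_of_betti_eq_zero hK hshift hb hG hp }
  have hfam := hshift.isShiftedFamily_facesOfDim hK (d := d)
  have h1 := hcone.tauHat_eq_det k hd hb (link_facesOfDim_nonempty hshift hK hd hdim)
  rw [h1, hshift.prod_longSignatures_del hK hd, facesOfDim_link]
  simp only [Xmon_eq_weight]
  exact hfam.det_reduced_laplacian (Xvar_ne_zero k)

/-- Two expressions for the factor of a long signature in the spanning tree enumerator. -/
theorem eigenvalue_eq_zpoly_div (k : Type*) [Field k] {S T : Finset ℤ} (hS : ∀ j ∈ S, p < j)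
    (hT : p ∉ T) :
    eigenvalue (Xvar k 1 p)⁻¹ (Xvar k) S (insert p T) =
        zpoly k S.val (p ::ₘ T.val) / Xvar k 1 p ∧
      eigenvalue (Xvar k 1 p)⁻¹ (Xvar k) S (insert p T) =
        ((p ::ₘ T.val).map fun j => Xmon k (j ::ₘ S.val)).sum / Xmon k (p ::ₘ S.val) := by
  have h1 : ((p ::ₘ T.val).map fun j => Xmon k (j ::ₘ S.val)).sum =
      ∑ j ∈ insert p T, weight (Xvar k) (j ::ₘ S.val) := by
    rw [← Finset.insert_val_of_notMem hT]
    simp only [Xmon_eq_weight]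
    rfl
  have h2 : Xmon k (p ::ₘ S.val) = Xvar k 1 p * weight (raise (Xvar k)) S.val := by
    rw [Xmon_eq_weight, weight_cons _ fun b hb => (hS b hb).le]
  have h3 := Xvar_ne_zero k 1 p
  have h4 : weight (raise (Xvar k)) S.val ≠ 0 :=
    weight_ne_zero (fun i j => Xvar_ne_zero k _ _) _
  rw [zpoly, h1, h2, raising_Xmon, eigenvalue]
  constructor <;> field_simp

end Faces

end ShiftedTrees

end

theorem theorem1p6 (k : Type*) [Field k] [CharZero k] (p q : ℤ) (d : ℕ)
    (K : Finset (Finset ℤ))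
    (hK : ShiftedTrees.IsComplexOn (Finset.Icc p q) K)
    (hshift : ShiftedTrees.IsShifted p q K)
    (hdim : ShiftedTrees.dim K = d)
    (hAPC : ShiftedTrees.IsAPC K) :
    ShiftedTrees.tauHat k (Finset.Icc p q) d K =
        (∏ F ∈ ShiftedTrees.facesOfDim (ShiftedTrees.link p K) ((d : ℤ) - 1),
            ShiftedTrees.Xmon k (insert p F).val) *
          ((ShiftedTrees.longSignatures
              (ShiftedTrees.facesOfDim (ShiftedTrees.del p K) d)).map fun ST =>
            ShiftedTrees.zpoly k ST.1.val (p ::ₘ ST.2.val) / ShiftedTrees.Xvar k 1 p).prod ∧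
    ShiftedTrees.tauHat k (Finset.Icc p q) d K =
        (∏ F ∈ ShiftedTrees.facesOfDim (ShiftedTrees.link p K) ((d : ℤ) - 1),
            ShiftedTrees.Xmon k (insert p F).val) *
          ((ShiftedTrees.longSignatures
              (ShiftedTrees.facesOfDim (ShiftedTrees.del p K) d)).map fun ST =>
            ((p ::ₘ ST.2.val).map fun j => ShiftedTrees.Xmon k (j ::ₘ ST.1.val)).sum /
              ShiftedTrees.Xmon k (p ::ₘ ST.1.val)).prod := by
  have hd : (0 : ℤ) ≤ d := Int.natCast_nonneg d
  rw [ShiftedTrees.tauHat_eq_prod k hK hshift hd hdim hAPC]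
  constructor <;> congr 1
  · exact hshift.prod_longSignatures_del_congr hK hd fun S T hS hT =>
      (ShiftedTrees.eigenvalue_eq_zpoly_div k hS hT).1
  · exact hshift.prod_longSignatures_del_congr hK hd fun S T hS hT =>
      (ShiftedTrees.eigenvalue_eq_zpoly_div k hS hT).2
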